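/- Let $G'$ be the four-cycle $X_1 - X_2 - X_3 - X_4 - X_1$ on four binary variables, and let $\mathcal X=\{0,1\}^4$. Let $A=A(G')$ be the $16\times 16$ matrix with columns indexed by $x\in\mathcal X$ and rows indexed by pairs $(C,y)$ of a maximal clique $C\in\{\{1,2\},\{2,3\},\{3,4\},\{1,4\}\}$ of $G'$ and $y\in\{0,1\}^C$, whose entry is $1$ if $x|_C=y$ and $0$ otherwise. A probability distribution $P=(p_x)_{x\in\mathcal X}$ *factors according to the four-cycle* if $p_x=\prod_{C}\psi_C(x|_C)$ for some nonnegative real functions $\psi_C$, i.e. if $P$ lies in the image of the monomial map $\phi_A(t)=\big(\prod_i t_i^{a_{ix}}\big)_{x}$, $t\in\mathbb R_{\ge 0}^{16}$. Let $I_A\subset\mathbb R[p_x : x\in\mathcal X]$ be the toric ideal of $A$, generated by all binomials $p^u-p^v$ with $u,v\in\mathbb N^{16}$ and $Au=Av$. Let $I_{\mathrm{pairwise}(G')}$ be the ideal generated by the cross-product differences of the statements "$X_2$ is independent of $X_4$ given $\{X_1,X_3\}$" and "$X_1$ is independent of $X_3$ given $\{X_2,X_4\}$", where for a nonedge $\{i,j\}$,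 levels $x\ne x'$ of $X_i$, levels $y\neq y'$ of $X_j$ and values $z$ of the other two variables the cross-product difference is $p_{(x,y,z)}p_{(x',y',z)}-p_{(x',y,z)}p_{(x,y',z)}$. Then: 1. The pairwise ideal is generated by eight quadrics: $$\begin{aligned} I_{\mathrm{pairwise}(G')} = \langle\, & p_{1011}p_{1110}-p_{1010}p_{1111},\ p_{0111}p_{1101}-p_{0101}p_{1111},\ p_{1001}p_{1100}-p_{1000}p_{1101},\ p_{0110}p_{1100}-p_{0100}p_{1110},\\ & p_{0011}p_{1001}-p_{0001}p_{1011},\ p_{0011}p_{0110}-p_{0010}p_{0111},\ p_{0001}p_{0100}-p_{0000}p_{0101},\ p_{0010}p_{1000}-p_{0000}p_{1010}\,\rangle. \end{aligned}$$ 2. $$I_{A(G')}=I_{\mathrm{pairwise}(G')}+\langle f_{12}^{\mathrm{diff}},f_{23}^{\mathrm{diff}},f_{34}^{\mathrm{diff}},f_{14}^{\mathrm{diff}},f_{12}^{\mathrm{same}},f_{23}^{\mathrm{same}},f_{34}^{\mathrm{same}},f_{14}^{\mathrm{same}}\rangle,$$ where $$\begin{aligned} f_{12}^{\mathrm{diff}}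 &= p_{0100}p_{0111}p_{1001}p_{1010} - p_{0101}p_{0110}p_{1000}p_{1011}, \\ f_{23}^{\mathrm{diff}} &= p_{0010}p_{0101}p_{1011}p_{1100} - p_{0011}p_{0100}p_{1010}p_{1101}, \\ f_{34}^{\mathrm{diff}} &= p_{0001}p_{0110}p_{1010}p_{1101} - p_{0010}p_{0101}p_{1001}p_{1110}, \\ f_{14}^{\mathrm{diff}} &= p_{0001}p_{0111}p_{1010}p_{1100} - p_{0011}p_{0101}p_{1000}p_{1110}, \\ f_{12}^{\mathrm{same}} &= p_{0000}p_{0011}p_{1101}p_{1110} - p_{0001}p_{0010}p_{1100}p_{1111}, \\ f_{23}^{\mathrm{same}} &= p_{0000}p_{0111}p_{1001}p_{1110} - p_{0001}p_{0110}p_{1000}p_{1111}, \\ f_{34}^{\mathrm{same}} &= p_{0000}p_{0111}p_{1011}p_{1100} - p_{0011}p_{0100}p_{1000}p_{1111}, \\ f_{14}^{\mathrm{same}} &= p_{0000}p_{0110}p_{1011}p_{1101} - p_{0010}p_{0100}p_{1001}p_{1111}. \end{aligned}$$ 3. A probability distribution $P$ on $\mathcal X$ factors according to the four-cycle or is the limit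 of a sequence of probability distributions that factor according to the four-cycle if and only if these eight quadrics and eight quartics all vanish at $P$. -/

import Mathlib

namespace GraphicalModel

open MvPolynomial

section Exponential

variable {d m : Type*}

/-- The monomial map `φ_A` of a `d × m` matrix `A` of nonnegative integers: the `j`-th coordinate
of `φ_A(t)` is `∏ i, t i ^ a i j` (with `0 ^ 0 = 1`). -/
def monomialMap [Fintype d] (A : Matrix d m ℕ) (t : d → ℝ) : m → ℝ :=
  fun j => ∏ i, t i ^ A i j

/-- `P` factors according to `A`: it is the image under `φ_A` of a nonnegative real vector. -/
def Factors [Fintype d] (A : Matrix d m ℕ) (P : m → ℝ) : Prop :=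
  ∃ t : d → ℝ, (∀ i, 0 ≤ t i) ∧ monomialMap A t = P

/-- `P` is the limit of a sequence of probability distributions that factor according to `A`. -/
def IsLimitOfFactoring [Fintype d] [Fintype m] (A : Matrix d m ℕ) (P : m → ℝ) : Prop :=
  ∃ Q : ℕ → m → ℝ, (∀ n, Q n ∈ stdSimplex ℝ m ∧ Factors A (Q n)) ∧
    Filter.Tendsto Q Filter.atTop (nhds P)

/-- The toric ideal `I_A ⊆ ℝ[x_j : j ∈ m]`, generated by the binomials `x ^ u - x ^ v` with
`A u = A v`. -/
noncomputable def toricIdeal [Fintype m] (A : Matrix d m ℕ) : Ideal (MvPolynomial m ℝ) :=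
  Ideal.span {f | ∃ u v : m →₀ ℕ, A.mulVec u = A.mulVec v ∧
    f = monomial u (1 : ℝ) - monomial v (1 : ℝ)}

end Exponential

section Graph

variable {V : Type*}

/-- The rows of the matrix of the log-linear model with the generators `𝒢`, for variables indexed
by `V` that all have the level set `L`: pairs of a generator and a value of its variables. -/
abbrev LogLinearRow (𝒢 : Finset (Finset V)) (L : Type*) : Type _ :=
  Σ g : {g : Finset V // g ∈ 𝒢}, ({v : V // v ∈ g.1} → L)

/-- The matrix of the log-linear model with the generators `𝒢`: the entry in row `(g, y)` and column
`x` is `1` if `y` is the restriction of the state `x` to the variables in `g`, and `0` otherwise. -/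
def logLinearMatrix (𝒢 : Finset (Finset V)) (L : Type*) [DecidableEq V] [DecidableEq L] :
    Matrix (LogLinearRow 𝒢 L) (V → L) ℕ :=
  fun r x => if r.2 = fun v => x v.1 then 1 else 0

open Classical in
/-- The maximal cliques (vertex sets of maximal complete subgraphs) of a finite graph. -/
noncomputable def maximalCliques [Fintype V] (G : SimpleGraph V) : Finset (Finset V) :=
  Finset.univ.filter fun C => Maximal (fun s : Finset V => G.IsClique (s : Set V)) C

/-- The matrix `A(G)` of the undirected graphical model of `G`: the log-linear model whose generators
are the maximal cliques of `G`. -/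
noncomputable def graphMatrix [Fintype V] [DecidableEq V] (G : SimpleGraph V)
    (L : Type*) [DecidableEq L] : Matrix (LogLinearRow (maximalCliques G) L) (V → L) ℕ :=
  logLinearMatrix (maximalCliques G) L

/-- The cross-product difference
`p(x, y, z) p(x', y', z) - p(x', y, z) p(x, y', z)` of the variables `i` and `j`, where `z` is the
restriction of the state `s` to the variables other than `i` and `j`. -/
noncomputable def cpd [DecidableEq V] {L : Type*} (i j : V) (x x' y y' : L) (s : V → L) :
    MvPolynomial (V → L) ℝ :=
  X (Function.update (Function.update s i x) j y) *
      X (Function.update (Function.update s i x') j y') -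
    X (Function.update (Function.update s i x') j y) *
      X (Function.update (Function.update s i x) j y')

/-- The pairwise ideal of `G`, generated by the cross-product differences of the statements
"`i` is independent of `j` given all other variables", for all nonedges `i, j` of `G`. -/
noncomputable def pairwiseIdeal [DecidableEq V] (G : SimpleGraph V) (L : Type*) :
    Ideal (MvPolynomial (V → L) ℝ) :=
  Ideal.span {f | ∃ i j : V, i ≠ j ∧ ¬ G.Adj i j ∧ ∃ x x' y y' : L, x ≠ x' ∧ y ≠ y' ∧
    ∃ s : V → L, f = cpd i j x x' y y' s}

end Graph

section FourCycle

/-- The four-cycle `0 - 1 - 2 - 3 - 0`; the vertex `k` stands for the variable `X_{k+1}`. -/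
abbrev fourCycle : SimpleGraph (Fin 4) := SimpleGraph.cycleGraph 4

/-- The matrix `A(G')` of the binary four-cycle model. -/
noncomputable abbrev fourCycleMatrix :
    Matrix (LogLinearRow (maximalCliques fourCycle) (Fin 2)) (Fin 4 → Fin 2) ℕ :=
  graphMatrix fourCycle (Fin 2)

/-- The indeterminate `p_{abcd}`. -/
noncomputable def p (a b c d : Fin 2) : MvPolynomial (Fin 4 → Fin 2) ℝ := X ![a, b, c, d]

/-- The eight quadrics of the pairwise conditional independence statements of the four-cycle. -/
noncomputable def quadrics : Set (MvPolynomial (Fin 4 → Fin 2) ℝ) :=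
  {p 1 0 1 1 * p 1 1 1 0 - p 1 0 1 0 * p 1 1 1 1,
   p 0 1 1 1 * p 1 1 0 1 - p 0 1 0 1 * p 1 1 1 1,
   p 1 0 0 1 * p 1 1 0 0 - p 1 0 0 0 * p 1 1 0 1,
   p 0 1 1 0 * p 1 1 0 0 - p 0 1 0 0 * p 1 1 1 0,
   p 0 0 1 1 * p 1 0 0 1 - p 0 0 0 1 * p 1 0 1 1,
   p 0 0 1 1 * p 0 1 1 0 - p 0 0 1 0 * p 0 1 1 1,
   p 0 0 0 1 * p 0 1 0 0 - p 0 0 0 0 * p 0 1 0 1,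
   p 0 0 1 0 * p 1 0 0 0 - p 0 0 0 0 * p 1 0 1 0}

noncomputable def f12diff : MvPolynomial (Fin 4 → Fin 2) ℝ :=
  p 0 1 0 0 * p 0 1 1 1 * p 1 0 0 1 * p 1 0 1 0 - p 0 1 0 1 * p 0 1 1 0 * p 1 0 0 0 * p 1 0 1 1

noncomputable def f23diff : MvPolynomial (Fin 4 → Fin 2) ℝ :=
  p 0 0 1 0 * p 0 1 0 1 * p 1 0 1 1 * p 1 1 0 0 - p 0 0 1 1 * p 0 1 0 0 * p 1 0 1 0 * p 1 1 0 1

noncomputable def f34diff : MvPolynomial (Fin 4 → Fin 2) ℝ :=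
  p 0 0 0 1 * p 0 1 1 0 * p 1 0 1 0 * p 1 1 0 1 - p 0 0 1 0 * p 0 1 0 1 * p 1 0 0 1 * p 1 1 1 0

noncomputable def f14diff : MvPolynomial (Fin 4 → Fin 2) ℝ :=
  p 0 0 0 1 * p 0 1 1 1 * p 1 0 1 0 * p 1 1 0 0 - p 0 0 1 1 * p 0 1 0 1 * p 1 0 0 0 * p 1 1 1 0

noncomputable def f12same : MvPolynomial (Fin 4 → Fin 2) ℝ :=
  p 0 0 0 0 * p 0 0 1 1 * p 1 1 0 1 * p 1 1 1 0 - p 0 0 0 1 * p 0 0 1 0 * p 1 1 0 0 * p 1 1 1 1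

noncomputable def f23same : MvPolynomial (Fin 4 → Fin 2) ℝ :=
  p 0 0 0 0 * p 0 1 1 1 * p 1 0 0 1 * p 1 1 1 0 - p 0 0 0 1 * p 0 1 1 0 * p 1 0 0 0 * p 1 1 1 1

noncomputable def f34same : MvPolynomial (Fin 4 → Fin 2) ℝ :=
  p 0 0 0 0 * p 0 1 1 1 * p 1 0 1 1 * p 1 1 0 0 - p 0 0 1 1 * p 0 1 0 0 * p 1 0 0 0 * p 1 1 1 1

noncomputable def f14same : MvPolynomial (Fin 4 → Fin 2) ℝ :=
  p 0 0 0 0 * p 0 1 1 0 * p 1 0 1 1 * p 1 1 0 1 - p 0 0 1 0 * p 0 1 0 0 * p 1 0 0 1 * p 1 1 1 1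

/-- The eight quartics. -/
noncomputable def quartics : Set (MvPolynomial (Fin 4 → Fin 2) ℝ) :=
  {f12diff, f23diff, f34diff, f14diff, f12same, f23same, f34same, f14same}

end FourCycle

end GraphicalModel

/-! The nonedges of the four-cycle are {1,3} and {2,4}, and on binary levels every cross-product
difference is, up to sign, one of the eight quadrics.

The equality of ideals is a connectivity statement: two tables with the same edge margins must be
joined by moves that stay nonnegative (`monRel_of_sameMargins`). Cut the cycle along {1,3}. If the
margins on {1,2,3} and {1,3,4} agree, then each slice with (X1, X3) fixed is a 2×2 table in (X2, X4)
with given row and column sums, and the 2-4 quadrics connect such tables (`monRel_of_marg_eq`). With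
the edge margins fixed, the {1,2,3} margin has one free number `margA u 0 b 0` for each level b of
X2, and the {1,3,4} margin one free number `margB u 0 0 d` for each level d of X4; the two families
are tied by their common sum, an entry of the {1,3} margin. A 1-3 quadric raises or lowers one
number of each family, and a quartic move shifts a unit inside one family. If the tables still
differ, one of these moves brings them closer, and equality of edge margins guarantees that the
cells it consumes can be made positive.

For the distributions, binomials with equal A-images vanish on the image of the monomial map, hence
on limits. Conversely, let P be a nonnegative zero of the toric ideal. Taking logarithms of the
binomials shows that log P agrees on the support with some θ in the row span
(`exists_mem_rowSpan_exp_eq`). A finite Boolean check shows that for each zero k of P there is a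
nonnegative element of the row span that vanishes on the support and is positive at k
(`exists_face`). If ω is the sum of these, then exp(θ - nω), normalized, factors and tends to P
(`isLimitOfFactoring_of_face`). -/

namespace GraphicalModel

open MvPolynomial

/-! ### Congruence of monomials modulo an ideal -/

section MonomialRelation

variable {m : Type*}

/-- Two monomials agree modulo the ideal `I`. -/
def MonRel (I : Ideal (MvPolynomial m ℝ)) (u v : m →₀ ℕ) : Prop :=
  monomial u (1 : ℝ) - monomial v (1 : ℝ) ∈ I

variable {I : Ideal (MvPolynomial m ℝ)} {u v w : m →₀ ℕ}

theorem MonRel.refl (u : m →₀ ℕ) : MonRel I u u := by simp [MonRel]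

theorem MonRel.symm (h : MonRel I u v) : MonRel I v u := by
  have := I.neg_mem h
  rwa [neg_sub] at this

theorem MonRel.trans (h : MonRel I u v) (h' : MonRel I v w) : MonRel I u w := by
  have := I.add_mem h h'
  rwa [sub_add_sub_cancel] at this

theorem MonRel.add_left (h : MonRel I u v) (w : m →₀ ℕ) : MonRel I (w + u) (w + v) := by
  have := I.mul_mem_left (monomial w (1 : ℝ)) h
  rwa [mul_sub, monomial_mul, monomial_mul, one_mul] at this

/-- A relation between monomials can be applied to every multiple of its first monomial. -/
theorem MonRel.exists_of_le {g h : m →₀ ℕ} (hgh : MonRel I g h) (hg : g ≤ u) :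
    ∃ u', MonRel I u u' ∧ ∀ x, u' x + g x = u x + h x := by
  obtain ⟨r, rfl⟩ := exists_add_of_le hg
  refine ⟨r + h, ?_, fun x => by simp only [Finsupp.add_apply]; ring⟩
  rw [add_comm g r]
  exact hgh.add_left r

/-- Lets divisibility by a squarefree monomial be assembled one positive cell at a time. -/
theorem single_add_le {g : m →₀ ℕ} {x : m} (hg : g ≤ u) (hx : g x = 0) (hu : 0 < u x) :
    Finsupp.single x 1 + g ≤ u := by
  classical
  intro y
  rw [Finsupp.add_apply, Finsupp.single_apply]
  split_ifs with h
  · subst h; omega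
  · simpa using hg y

theorem monRel_two (a b c d : m) : MonRel I (Finsupp.single a 1 + Finsupp.single b 1)
    (Finsupp.single c 1 + Finsupp.single d 1) ↔ X a * X b - X c * X d ∈ I := by
  simp [MonRel, X, monomial_mul]

theorem monRel_four (a b c d a' b' c' d' : m) :
    MonRel I (Finsupp.single a 1 + (Finsupp.single b 1 + (Finsupp.single c 1 + Finsupp.single d 1)))
      (Finsupp.single a' 1 +
        (Finsupp.single b' 1 + (Finsupp.single c' 1 + Finsupp.single d' 1))) ↔
    X a * X b * X c * X d - X a' * X b' * X c' * X d' ∈ I := by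
  simp [MonRel, X, monomial_mul, add_assoc]

end MonomialRelation

/-! ### The matrix of a log-linear model computes margins -/

section LogLinear

variable {V L : Type*} [DecidableEq V] (𝒢 : Finset (Finset V))

theorem exists_eq_restrict [Nonempty L] (r : LogLinearRow 𝒢 L) :
    ∃ y : V → L, r = ⟨r.1, fun v => y v.1⟩ := by
  classical
  obtain ⟨g, y⟩ := r
  refine ⟨fun v => if h : v ∈ g.1 then y ⟨v, h⟩ else Classical.arbitrary L, ?_⟩
  congr
  funext v
  simp

variable [DecidableEq L]

theorem logLinearMatrix_restrict {g : Finset V} (hg : g ∈ 𝒢) (y x : V → L) :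
    logLinearMatrix 𝒢 L ⟨⟨g, hg⟩, fun v => y v.1⟩ x = if ∀ v ∈ g, y v = x v then 1 else 0 := by
  simp only [logLinearMatrix, funext_iff, Subtype.forall]

variable [Fintype V] [Fintype L]

theorem logLinearMatrix_mulVec_eq_iff [Nonempty L] (u v : (V → L) → ℕ) :
    (logLinearMatrix 𝒢 L).mulVec u = (logLinearMatrix 𝒢 L).mulVec v ↔
      ∀ g ∈ 𝒢, ∀ y : V → L, (∑ x, if ∀ v ∈ g, y v = x v then u x else 0) =
        ∑ x, if ∀ v ∈ g, y v = x v then v x else 0 := by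
  have key : ∀ (w : (V → L) → ℕ) g (hg : g ∈ 𝒢) (y : V → L),
      (logLinearMatrix 𝒢 L).mulVec w ⟨⟨g, hg⟩, fun v => y v.1⟩ =
        ∑ x, if ∀ v ∈ g, y v = x v then w x else 0 := by
    intro w g hg y
    simp [Matrix.mulVec, dotProduct, logLinearMatrix_restrict]
  constructor
  · intro h g hg y
    rw [← key u g hg y, ← key v g hg y, h]
  · intro h
    funext r
    obtain ⟨y, hy⟩ := exists_eq_restrict 𝒢 r
    rw [hy, key, key]
    exact h _ r.1.2 y

end LogLinear

/-! ### Margins of tables on the four-cycle -/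

section FourCycle

theorem maximalCliques_fourCycle :
    maximalCliques fourCycle = {{0, 1}, {1, 2}, {2, 3}, {0, 3}} := by
  have hc : ∀ s : Finset (Fin 4), fourCycle.IsClique (s : Set (Fin 4)) ↔
      ∀ a ∈ s, ∀ b ∈ s, a ≠ b → fourCycle.Adj a b := fun s => Iff.rfl
  ext C
  simp only [maximalCliques, Finset.mem_filter, Finset.mem_univ, true_and, Maximal, hc]
  revert C
  decide

theorem sum_states {M : Type*} [AddCommMonoid M] (f : (Fin 4 → Fin 2) → M) :
    ∑ x, f x = ∑ a, ∑ b, ∑ c, ∑ d, f ![a, b, c, d] := by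
  simp only [← Fintype.sum_prod_type']
  refine Fintype.sum_equiv
    ⟨fun x => (x 0, x 1, x 2, x 3), fun t => ![t.1, t.2.1, t.2.2.1, t.2.2.2], ?_, ?_⟩ _ _ ?_
  · intro x
    funext i
    fin_cases i <;> rfl
  · intro t
    rfl
  · intro x
    congr 1
    funext i
    fin_cases i <;> rfl

/-- The marginal of `u` on the first three variables. -/
def margA (u : (Fin 4 → Fin 2) →₀ ℕ) (a b c : Fin 2) : ℕ := u ![a, b, c, 0] + u ![a, b, c, 1]

/-- The marginal of `u` on the first, third and fourth variables. -/
def margB (u : (Fin 4 → Fin 2) →₀ ℕ) (a c d : Fin 2) : ℕ := u ![a, 0, c, d] + u ![a, 1, c, d]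

/-- `u` and `v` have the same marginals on the edges of the four-cycle. -/
structure SameMargins (u v : (Fin 4 → Fin 2) →₀ ℕ) : Prop where
  m12 : ∀ a b, margA u a b 0 + margA u a b 1 = margA v a b 0 + margA v a b 1
  m23 : ∀ b c, margA u 0 b c + margA u 1 b c = margA v 0 b c + margA v 1 b c
  m34 : ∀ c d, margB u 0 c d + margB u 1 c d = margB v 0 c d + margB v 1 c d
  m14 : ∀ a d, margB u a 0 d + margB u a 1 d = margB v a 0 d + margB v a 1 d

theorem fourCycleMatrix_mulVec_eq_iff (u v : (Fin 4 → Fin 2) →₀ ℕ) :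
    fourCycleMatrix.mulVec u = fourCycleMatrix.mulVec v ↔ SameMargins u v := by
  rw [fourCycleMatrix, graphMatrix, logLinearMatrix_mulVec_eq_iff, maximalCliques_fourCycle]
  simp only [Finset.mem_insert, Finset.mem_singleton, forall_eq_or_imp, forall_eq, sum_states,
    Fin.sum_univ_two, Matrix.cons_val]
  constructor
  · rintro ⟨h1, h2, h3, h4⟩
    constructor
    · intro a b
      have := h1 ![a, b, 0, 0]
      fin_cases a <;> fin_cases b <;> simp [margA] at this ⊢ <;> omega
    · intro a b
      have := h2 ![0, a, b, 0]
      fin_cases a <;> fin_cases b <;> simp [margA] at this ⊢ <;> omega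
    · intro a b
      have := h3 ![0, 0, a, b]
      fin_cases a <;> fin_cases b <;> simp [margB] at this ⊢ <;> omega
    · intro a b
      have := h4 ![a, 0, 0, b]
      fin_cases a <;> fin_cases b <;> simp [margB] at this ⊢ <;> omega
  · rintro ⟨h1, h2, h3, h4⟩
    refine ⟨fun y => ?_, fun y => ?_, fun y => ?_, fun y => ?_⟩
    · have := h1 (y 0) (y 1)
      generalize y 0 = a at *
      generalize y 1 = b at *
      fin_cases a <;> fin_cases b <;> simp [margA] at this ⊢ <;> omega
    · have := h2 (y 1) (y 2)
      generalize y 1 = a at *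
      generalize y 2 = b at *
      fin_cases a <;> fin_cases b <;> simp [margA] at this ⊢ <;> omega
    · have := h3 (y 2) (y 3)
      generalize y 2 = a at *
      generalize y 3 = b at *
      fin_cases a <;> fin_cases b <;> simp [margB] at this ⊢ <;> omega
    · have := h4 (y 0) (y 3)
      generalize y 0 = a at *
      generalize y 3 = b at *
      fin_cases a <;> fin_cases b <;> simp [margB] at this ⊢ <;> omega

end FourCycle

/-! ### The pairwise ideal -/

section Quadrics

theorem cross_one_three_mem (b d : Fin 2) :
    p 0 b 1 d * p 1 b 0 d - p 0 b 0 d * p 1 b 1 d ∈ Ideal.span quadrics := by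
  apply Ideal.subset_span
  fin_cases b <;> fin_cases d <;> simp [quadrics]

theorem cross_two_four_mem (a c : Fin 2) :
    p a 0 c 1 * p a 1 c 0 - p a 0 c 0 * p a 1 c 1 ∈ Ideal.span quadrics := by
  apply Ideal.subset_span
  fin_cases a <;> fin_cases c <;> simp [quadrics]

theorem update_one_three (s : Fin 4 → Fin 2) (x y : Fin 2) :
    Function.update (Function.update s 0 x) 2 y = ![x, s 1, y, s 3] := by
  funext i
  fin_cases i <;> simp [Function.update]

theorem update_two_four (s : Fin 4 → Fin 2) (x y : Fin 2) :
    Function.update (Function.update s 1 x) 3 y = ![s 0, x, s 2, y] := by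
  funext i
  fin_cases i <;> simp [Function.update]

theorem not_adj_fourCycle : ∀ i j : Fin 4, i ≠ j → ¬ fourCycle.Adj i j →
    i = 0 ∧ j = 2 ∨ i = 2 ∧ j = 0 ∨ i = 1 ∧ j = 3 ∨ i = 3 ∧ j = 1 := by
  decide

theorem mem_of_eq_or_eq_neg {R : Type*} [Ring R] {I : Ideal R} {f g : R} (hg : g ∈ I)
    (h : f = g ∨ f = -g) : f ∈ I := by
  rcases h with rfl | rfl
  · exact hg
  · exact I.neg_mem hg

theorem cpd_comm {V L : Type*} [DecidableEq V] {i j : V} (hij : i ≠ j) (x x' y y' : L) (s : V → L) :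
    cpd j i y y' x x' s = cpd i j x x' y y' s := by
  simp only [cpd, Function.update_comm hij.symm]
  ring

theorem cpd_one_three_mem {x x' y y' : Fin 2} (hx : x ≠ x') (hy : y ≠ y') (s : Fin 4 → Fin 2) :
    cpd 0 2 x x' y y' s ∈ Ideal.span quadrics := by
  refine mem_of_eq_or_eq_neg (cross_one_three_mem (s 1) (s 3)) ?_
  simp only [cpd, update_one_three, p]
  generalize s 1 = b, s 3 = d
  fin_cases x <;> fin_cases x' <;> simp at hx <;> fin_cases y <;> fin_cases y' <;> simp at hy
  · right; simp; ring
  · left; simp; ring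
  · left; simp; ring
  · right; simp; ring

theorem cpd_two_four_mem {x x' y y' : Fin 2} (hx : x ≠ x') (hy : y ≠ y') (s : Fin 4 → Fin 2) :
    cpd 1 3 x x' y y' s ∈ Ideal.span quadrics := by
  refine mem_of_eq_or_eq_neg (cross_two_four_mem (s 0) (s 2)) ?_
  simp only [cpd, update_two_four, p]
  generalize s 0 = b, s 2 = d
  fin_cases x <;> fin_cases x' <;> simp at hx <;> fin_cases y <;> fin_cases y' <;> simp at hy
  · right; simp; ring
  · left; simp; ring
  · left; simp; ring
  · right; simp; ring

theorem pairwiseIdeal_fourCycle : pairwiseIdeal fourCycle (Fin 2) = Ideal.span quadrics := by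
  apply le_antisymm
  · refine Ideal.span_le.2 ?_
    rintro f ⟨i, j, hij, hadj, x, x', y, y', hx, hy, s, rfl⟩
    rcases not_adj_fourCycle i j hij hadj with ⟨rfl, rfl⟩ | ⟨rfl, rfl⟩ | ⟨rfl, rfl⟩ | ⟨rfl, rfl⟩
    · exact cpd_one_three_mem hx hy s
    · rw [cpd_comm (by decide)]
      exact cpd_one_three_mem hy hx s
    · exact cpd_two_four_mem hx hy s
    · rw [cpd_comm (by decide)]
      exact cpd_two_four_mem hy hx s
  · have h13 : ∀ b d : Fin 2, p 0 b 1 d * p 1 b 0 d - p 0 b 0 d * p 1 b 1 d ∈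
        pairwiseIdeal fourCycle (Fin 2) := by
      intro b d
      refine Ideal.subset_span ⟨0, 2, by decide, by decide, 0, 1, 1, 0, by decide, by decide,
        ![0, b, 0, d], ?_⟩
      simp only [cpd, update_one_three, p]
      simp
      ring
    have h24 : ∀ a c : Fin 2, p a 0 c 1 * p a 1 c 0 - p a 0 c 0 * p a 1 c 1 ∈
        pairwiseIdeal fourCycle (Fin 2) := by
      intro a c
      refine Ideal.subset_span ⟨1, 3, by decide, by decide, 0, 1, 1, 0, by decide, by decide,
        ![a, 0, c, 0], ?_⟩
      simp only [cpd, update_two_four, p]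
      simp
      ring
    refine Ideal.span_le.2 ?_
    rintro f (rfl | rfl | rfl | rfl | rfl | rfl | rfl | rfl)
    exacts [h24 1 1, h13 1 1, h24 1 0, h13 1 0, h13 0 1, h24 0 1, h24 0 0, h13 0 0]

end Quadrics

/-! ### Reducing the quartic moves to the listed binomials -/

section Quartics

variable {S : Type*} [CommRing S]

/-- The move flips X2 in four cells, one for each value of (X1, X3), and keeps X4 = `w a c`. Of the
sixteen choices of `w`, only those that are a nonconstant function of X1 alone or of X3 alone need a
quartic: X4 equal to X1 or X3 gives a "same" quartic, X4 opposite to it a "diff" one. The other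
twelve binomials are combinations of the quadrics. -/
theorem quartic_cross_two (P : Fin 2 → Fin 2 → Fin 2 → Fin 2 → S)
    (hq0 : P 1 0 1 1 * P 1 1 1 0 - P 1 0 1 0 * P 1 1 1 1 = 0)
    (hq1 : P 0 1 1 1 * P 1 1 0 1 - P 0 1 0 1 * P 1 1 1 1 = 0)
    (hq2 : P 1 0 0 1 * P 1 1 0 0 - P 1 0 0 0 * P 1 1 0 1 = 0)
    (hq3 : P 0 1 1 0 * P 1 1 0 0 - P 0 1 0 0 * P 1 1 1 0 = 0)
    (hq4 : P 0 0 1 1 * P 1 0 0 1 - P 0 0 0 1 * P 1 0 1 1 = 0)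
    (hq5 : P 0 0 1 1 * P 0 1 1 0 - P 0 0 1 0 * P 0 1 1 1 = 0)
    (hq6 : P 0 0 0 1 * P 0 1 0 0 - P 0 0 0 0 * P 0 1 0 1 = 0)
    (hq7 : P 0 0 1 0 * P 1 0 0 0 - P 0 0 0 0 * P 1 0 1 0 = 0)
    (hf34d : P 0 0 0 1 * P 0 1 1 0 * P 1 0 1 0 * P 1 1 0 1 -
      P 0 0 1 0 * P 0 1 0 1 * P 1 0 0 1 * P 1 1 1 0 = 0)
    (hf14d : P 0 0 0 1 * P 0 1 1 1 * P 1 0 1 0 * P 1 1 0 0 -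
      P 0 0 1 1 * P 0 1 0 1 * P 1 0 0 0 * P 1 1 1 0 = 0)
    (hf34s : P 0 0 0 0 * P 0 1 1 1 * P 1 0 1 1 * P 1 1 0 0 -
      P 0 0 1 1 * P 0 1 0 0 * P 1 0 0 0 * P 1 1 1 1 = 0)
    (hf14s : P 0 0 0 0 * P 0 1 1 0 * P 1 0 1 1 * P 1 1 0 1 -
      P 0 0 1 0 * P 0 1 0 0 * P 1 0 0 1 * P 1 1 1 1 = 0)
    (w : Fin 2 → Fin 2 → Fin 2) :
    P 1 0 0 (w 1 0) * P 0 0 1 (w 0 1) * P 0 1 0 (w 0 0) * P 1 1 1 (w 1 1) -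
      P 1 1 0 (w 1 0) * P 0 1 1 (w 0 1) * P 0 0 0 (w 0 0) * P 1 0 1 (w 1 1) = 0 := by
  generalize w 0 0 = w00, w 0 1 = w01, w 1 0 = w10, w 1 1 = w11
  fin_cases w00 <;> fin_cases w01 <;> fin_cases w10 <;> fin_cases w11 <;>
    simp only [Fin.zero_eta, Fin.mk_one]
  · linear_combination - P 0 0 1 0 * P 1 0 0 0 * hq3 + P 0 1 1 0 * P 1 1 0 0 * hq7
  · linear_combination P 0 1 0 0 * P 1 1 1 1 * hq7 - P 0 0 0 0 * P 0 1 0 0 * hq0 -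
      P 0 0 0 0 * P 1 0 1 1 * hq3
  · linear_combination - P 0 0 1 0 * P 1 0 0 1 * hq3 + P 0 0 1 0 * P 0 1 1 0 * hq2 +
      P 0 1 1 0 * P 1 1 0 1 * hq7
  · linear_combination - hf14s
  · linear_combination - P 0 0 1 1 * P 1 0 0 0 * hq3 + P 1 0 0 0 * P 1 1 0 0 * hq5 +
      P 0 1 1 1 * P 1 1 0 0 * hq7
  · linear_combination - hf34s
  · linear_combination - P 0 0 1 1 * P 1 0 0 1 * hq3 + P 0 0 1 1 * P 0 1 1 0 * hq2 +
      P 1 0 0 0 * P 1 1 0 1 * hq5 + P 0 1 1 1 * P 1 1 0 1 * hq7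
  · linear_combination P 0 1 0 0 * P 1 1 1 1 * hq4 + P 1 0 1 1 * P 1 1 1 1 * hq6 -
      P 0 0 0 0 * P 1 0 1 1 * hq1
  · linear_combination P 0 1 0 1 * P 1 1 1 0 * hq7 - P 1 0 1 0 * P 1 1 1 0 * hq6 -
      P 0 0 0 1 * P 1 0 1 0 * hq3
  · linear_combination - P 0 0 1 0 * P 1 0 0 0 * hq1 - P 0 0 1 0 * P 0 1 1 1 * hq2 -
      P 1 0 0 1 * P 1 1 0 0 * hq5 + P 0 1 1 0 * P 1 1 0 0 * hq4
  · linear_combination - hf34d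
  · linear_combination - P 0 0 1 0 * P 1 0 0 1 * hq1 - P 1 0 0 1 * P 1 1 0 1 * hq5 +
      P 0 1 1 0 * P 1 1 0 1 * hq4
  · linear_combination - hf14d
  · linear_combination - P 0 0 1 1 * P 1 0 0 0 * hq1 - P 0 0 1 1 * P 0 1 1 1 * hq2 +
      P 0 1 1 1 * P 1 1 0 0 * hq4
  · linear_combination P 0 1 0 1 * P 1 1 1 0 * hq4 + P 0 0 0 1 * P 0 1 0 1 * hq0 -
      P 0 0 0 1 * P 1 0 1 0 * hq1
  · linear_combination - P 0 0 1 1 * P 1 0 0 1 * hq1 + P 0 1 1 1 * P 1 1 0 1 * hq4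

/-- The mirror image under exchange of X2 and X4: here `w a c` is the level of X2, and the four
quartics involved are those of the edges 12 and 23. -/
theorem quartic_cross_four (P : Fin 2 → Fin 2 → Fin 2 → Fin 2 → S)
    (hq0 : P 1 0 1 1 * P 1 1 1 0 - P 1 0 1 0 * P 1 1 1 1 = 0)
    (hq1 : P 0 1 1 1 * P 1 1 0 1 - P 0 1 0 1 * P 1 1 1 1 = 0)
    (hq2 : P 1 0 0 1 * P 1 1 0 0 - P 1 0 0 0 * P 1 1 0 1 = 0)
    (hq3 : P 0 1 1 0 * P 1 1 0 0 - P 0 1 0 0 * P 1 1 1 0 = 0)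
    (hq4 : P 0 0 1 1 * P 1 0 0 1 - P 0 0 0 1 * P 1 0 1 1 = 0)
    (hq5 : P 0 0 1 1 * P 0 1 1 0 - P 0 0 1 0 * P 0 1 1 1 = 0)
    (hq6 : P 0 0 0 1 * P 0 1 0 0 - P 0 0 0 0 * P 0 1 0 1 = 0)
    (hq7 : P 0 0 1 0 * P 1 0 0 0 - P 0 0 0 0 * P 1 0 1 0 = 0)
    (hf12d : P 0 1 0 0 * P 0 1 1 1 * P 1 0 0 1 * P 1 0 1 0 -
      P 0 1 0 1 * P 0 1 1 0 * P 1 0 0 0 * P 1 0 1 1 = 0)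
    (hf23d : P 0 0 1 0 * P 0 1 0 1 * P 1 0 1 1 * P 1 1 0 0 -
      P 0 0 1 1 * P 0 1 0 0 * P 1 0 1 0 * P 1 1 0 1 = 0)
    (hf12s : P 0 0 0 0 * P 0 0 1 1 * P 1 1 0 1 * P 1 1 1 0 -
      P 0 0 0 1 * P 0 0 1 0 * P 1 1 0 0 * P 1 1 1 1 = 0)
    (hf23s : P 0 0 0 0 * P 0 1 1 1 * P 1 0 0 1 * P 1 1 1 0 -
      P 0 0 0 1 * P 0 1 1 0 * P 1 0 0 0 * P 1 1 1 1 = 0)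
    (w : Fin 2 → Fin 2 → Fin 2) :
    P 1 (w 1 0) 0 0 * P 0 (w 0 1) 1 0 * P 0 (w 0 0) 0 1 * P 1 (w 1 1) 1 1 -
      P 1 (w 1 0) 0 1 * P 0 (w 0 1) 1 1 * P 0 (w 0 0) 0 0 * P 1 (w 1 1) 1 0 = 0 := by
  generalize w 0 0 = w00, w 0 1 = w01, w 1 0 = w10, w 1 1 = w11
  fin_cases w00 <;> fin_cases w01 <;> fin_cases w10 <;> fin_cases w11 <;>
    simp only [Fin.zero_eta, Fin.mk_one]
  · linear_combination - P 0 0 1 0 * P 1 0 0 0 * hq4 + P 0 0 1 1 * P 1 0 0 1 * hq7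
  · linear_combination P 0 0 0 1 * P 1 1 1 1 * hq7 - P 0 0 0 0 * P 0 0 0 1 * hq0 -
      P 0 0 0 0 * P 1 1 1 0 * hq4
  · linear_combination - P 0 0 1 0 * P 1 1 0 0 * hq4 + P 0 0 1 0 * P 0 0 1 1 * hq2 +
      P 0 0 1 1 * P 1 1 0 1 * hq7
  · linear_combination - hf12s
  · linear_combination - P 0 1 1 0 * P 1 0 0 0 * hq4 + P 1 0 0 0 * P 1 0 0 1 * hq5 +
      P 0 1 1 1 * P 1 0 0 1 * hq7
  · linear_combination - hf23s
  · linear_combination P 0 0 0 1 * P 1 0 1 1 * hq3 + P 0 0 0 1 * P 0 1 0 0 * hq0 +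
      P 1 0 1 0 * P 1 1 1 1 * hq6 - P 0 0 0 0 * P 1 0 1 0 * hq1
  · linear_combination P 0 0 0 1 * P 1 1 1 1 * hq3 + P 1 1 1 0 * P 1 1 1 1 * hq6 -
      P 0 0 0 0 * P 1 1 1 0 * hq1
  · linear_combination P 0 1 0 1 * P 1 0 1 1 * hq7 - P 1 0 1 0 * P 1 0 1 1 * hq6 -
      P 0 1 0 0 * P 1 0 1 0 * hq4
  · linear_combination - P 0 0 1 0 * P 1 0 0 0 * hq1 - P 0 0 1 0 * P 0 1 1 1 * hq2 -
      P 1 0 0 1 * P 1 1 0 0 * hq5 + P 0 0 1 1 * P 1 0 0 1 * hq3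
  · linear_combination hf23d
  · linear_combination - P 0 0 1 0 * P 1 1 0 0 * hq1 - P 1 1 0 0 * P 1 1 0 1 * hq5 +
      P 0 0 1 1 * P 1 1 0 1 * hq3
  · linear_combination - hf12d
  · linear_combination - P 0 1 1 0 * P 1 0 0 0 * hq1 - P 0 1 1 0 * P 0 1 1 1 * hq2 +
      P 0 1 1 1 * P 1 0 0 1 * hq3
  · linear_combination P 0 1 0 1 * P 1 0 1 1 * hq3 + P 0 1 0 0 * P 0 1 0 1 * hq0 -
      P 0 1 0 0 * P 1 0 1 0 * hq1
  · linear_combination - P 0 1 1 0 * P 1 1 0 0 * hq1 + P 0 1 1 1 * P 1 1 0 1 * hq3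

end Quartics

/-! ### The moves available modulo the candidate ideal -/

section MarkovMoves

/-- The ideal generated by the eight quadrics and the eight quartics. -/
noncomputable def markovIdeal : Ideal (MvPolynomial (Fin 4 → Fin 2) ℝ) :=
  Ideal.span quadrics ⊔ Ideal.span quartics

/-- The unit table supported at one state. -/
noncomputable def E (a b c d : Fin 2) : (Fin 4 → Fin 2) →₀ ℕ := Finsupp.single ![a, b, c, d] 1

theorem E_apply (a b c d a' b' c' d' : Fin 2) :
    E a b c d ![a', b', c', d'] = if a = a' ∧ b = b' ∧ c = c' ∧ d = d' then 1 else 0 := by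
  simp [E, Finsupp.single_apply]

theorem mk_quadric {f : MvPolynomial (Fin 4 → Fin 2) ℝ} (hf : f ∈ Ideal.span quadrics) :
    Ideal.Quotient.mk markovIdeal f = 0 :=
  Ideal.Quotient.eq_zero_iff_mem.2 (Ideal.mem_sup_left hf)

theorem mk_quartic {f : MvPolynomial (Fin 4 → Fin 2) ℝ} (hf : f ∈ quartics) :
    Ideal.Quotient.mk markovIdeal f = 0 :=
  Ideal.Quotient.eq_zero_iff_mem.2 (Ideal.mem_sup_right (Ideal.subset_span hf))

theorem monRel_one_three (b d : Fin 2) :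
    MonRel markovIdeal (E 1 b 0 d + E 0 b 1 d) (E 0 b 0 d + E 1 b 1 d) := by
  rw [E, E, E, E, monRel_two, mul_comm]
  exact Ideal.mem_sup_left (cross_one_three_mem b d)

/-- Two cells with the same (X1, X3) may exchange their X4 levels. If the X2 or the X4 levels
coincide nothing happens; otherwise the relation is a 2-4 quadric read in one of two directions. -/
theorem monRel_two_four (a c b b' d d' : Fin 2) :
    MonRel markovIdeal (E a b c d + E a b' c d') (E a b c d' + E a b' c d) := by
  have h : MonRel markovIdeal (E a 0 c 1 + E a 1 c 0) (E a 0 c 0 + E a 1 c 1) := by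
    rw [E, E, E, E, monRel_two]
    exact Ideal.mem_sup_left (cross_two_four_mem a c)
  by_cases hb : b = b'
  · subst hb
    rw [add_comm]
    exact MonRel.refl _
  by_cases hd : d = d'
  · subst hd
    exact MonRel.refl _
  have h2 : ∀ x y : Fin 2, x ≠ y → x = 0 ∧ y = 1 ∨ x = 1 ∧ y = 0 := by decide
  rcases h2 b b' hb with ⟨rfl, rfl⟩ | ⟨rfl, rfl⟩ <;>
    rcases h2 d d' hd with ⟨rfl, rfl⟩ | ⟨rfl, rfl⟩
  · exact h.symm
  · exact h
  · rw [add_comm, add_comm (E a 1 c 1)]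
    exact h
  · rw [add_comm, add_comm (E a 1 c 0)]
    exact h.symm

theorem monRel_quartic_two (w : Fin 2 → Fin 2 → Fin 2) :
    MonRel markovIdeal
      (E 1 0 0 (w 1 0) + (E 0 0 1 (w 0 1) + (E 0 1 0 (w 0 0) + E 1 1 1 (w 1 1))))
      (E 1 1 0 (w 1 0) + (E 0 1 1 (w 0 1) + (E 0 0 0 (w 0 0) + E 1 0 1 (w 1 1)))) := by
  simp only [E, monRel_four]
  -- In the quotient ring the quadrics and quartics are zero, so the ring identity
  -- `quartic_cross_two` applies.
  rw [← Ideal.Quotient.eq_zero_iff_mem]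
  simp only [map_sub, map_mul]
  have h13 := fun b d => mk_quadric (cross_one_three_mem b d)
  have h24 := fun a c => mk_quadric (cross_two_four_mem a c)
  have h34d := mk_quartic (f := f34diff) (by simp [quartics])
  have h14d := mk_quartic (f := f14diff) (by simp [quartics])
  have h34s := mk_quartic (f := f34same) (by simp [quartics])
  have h14s := mk_quartic (f := f14same) (by simp [quartics])
  simp only [map_sub, map_mul, p, f34diff, f14diff, f34same, f14same] at h13 h24 h34d h14d h34s h14s
  refine quartic_cross_two (fun a b c d => Ideal.Quotient.mk markovIdeal (X ![a, b, c, d]))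
    ?_ ?_ ?_ ?_ ?_ ?_ ?_ ?_ h34d h14d h34s h14s w
  exacts [h24 1 1, h13 1 1, h24 1 0, h13 1 0, h13 0 1, h24 0 1, h24 0 0, h13 0 0]

theorem monRel_quartic_four (w : Fin 2 → Fin 2 → Fin 2) :
    MonRel markovIdeal
      (E 1 (w 1 0) 0 0 + (E 0 (w 0 1) 1 0 + (E 0 (w 0 0) 0 1 + E 1 (w 1 1) 1 1)))
      (E 1 (w 1 0) 0 1 + (E 0 (w 0 1) 1 1 + (E 0 (w 0 0) 0 0 + E 1 (w 1 1) 1 0))) := by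
  simp only [E, monRel_four]
  rw [← Ideal.Quotient.eq_zero_iff_mem]
  simp only [map_sub, map_mul]
  have h13 := fun b d => mk_quadric (cross_one_three_mem b d)
  have h24 := fun a c => mk_quadric (cross_two_four_mem a c)
  have h12d := mk_quartic (f := f12diff) (by simp [quartics])
  have h23d := mk_quartic (f := f23diff) (by simp [quartics])
  have h12s := mk_quartic (f := f12same) (by simp [quartics])
  have h23s := mk_quartic (f := f23same) (by simp [quartics])
  simp only [map_sub, map_mul, p, f12diff, f23diff, f12same, f23same] at h13 h24 h12d h23d h12s h23s
  refine quartic_cross_four (fun a b c d => Ideal.Quotient.mk markovIdeal (X ![a, b, c, d]))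
    ?_ ?_ ?_ ?_ ?_ ?_ ?_ ?_ h12d h23d h12s h23s w
  exacts [h24 1 1, h13 1 1, h24 1 0, h13 1 0, h13 0 1, h24 0 1, h24 0 0, h13 0 0]

end MarkovMoves

/-! ### Effect of the moves on the margins -/

section Margins

variable {u u' v w g h : (Fin 4 → Fin 2) →₀ ℕ}

theorem margA_E (a b c d a' b' c' : Fin 2) :
    margA (E a b c d) a' b' c' = if a = a' ∧ b = b' ∧ c = c' then 1 else 0 := by
  have : d = 0 ∨ d = 1 := by revert d; decide
  rcases this with rfl | rfl <;> simp [margA, E_apply]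

theorem margB_E (a b c d a' c' d' : Fin 2) :
    margB (E a b c d) a' c' d' = if a = a' ∧ c = c' ∧ d = d' then 1 else 0 := by
  have : b = 0 ∨ b = 1 := by revert b; decide
  rcases this with rfl | rfl <;> simp [margB, E_apply]

theorem margA_add (a b c : Fin 2) : margA (u + v) a b c = margA u a b c + margA v a b c := by
  simp only [margA, Finsupp.add_apply]; ring

theorem margB_add (a c d : Fin 2) : margB (u + v) a c d = margB u a c d + margB v a c d := by
  simp only [margB, Finsupp.add_apply]; ring

theorem SameMargins.symm (h : SameMargins u v) : SameMargins v u :=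
  ⟨fun a b => (h.m12 a b).symm, fun a b => (h.m23 a b).symm, fun a b => (h.m34 a b).symm,
    fun a b => (h.m14 a b).symm⟩

theorem SameMargins.trans (h : SameMargins u v) (h' : SameMargins v w) : SameMargins u w :=
  ⟨fun a b => (h.m12 a b).trans (h'.m12 a b), fun a b => (h.m23 a b).trans (h'.m23 a b),
    fun a b => (h.m34 a b).trans (h'.m34 a b), fun a b => (h.m14 a b).trans (h'.m14 a b)⟩

theorem margA_of_move (hu : ∀ x, u' x + g x = u x + h x) (a b c : Fin 2) :
    margA u' a b c + margA g a b c = margA u a b c + margA h a b c := by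
  rw [← margA_add, ← margA_add]
  simp only [margA, Finsupp.add_apply, hu]

theorem margB_of_move (hu : ∀ x, u' x + g x = u x + h x) (a c d : Fin 2) :
    margB u' a c d + margB g a c d = margB u a c d + margB h a c d := by
  rw [← margB_add, ← margB_add]
  simp only [margB, Finsupp.add_apply, hu]

/-- The replacement of `g` by `h` inside `u` is recorded additively, which avoids truncated
subtraction. -/
theorem sameMargins_of_move (hA : ∀ a b c, margA u' a b c + margA g a b c =
      margA u a b c + margA h a b c)
    (hB : ∀ a c d, margB u' a c d + margB g a c d = margB u a c d + margB h a c d)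
    (hgh : SameMargins g h) : SameMargins u u' := by
  constructor
  · intro a b
    have := hgh.m12 a b
    have := hA a b 0
    have := hA a b 1
    omega
  · intro b c
    have := hgh.m23 b c
    have := hA 0 b c
    have := hA 1 b c
    omega
  · intro c d
    have := hgh.m34 c d
    have := hB 0 c d
    have := hB 1 c d
    omega
  · intro a d
    have := hgh.m14 a d
    have := hB a 0 d
    have := hB a 1 d
    omega

theorem sameMargins_two_four (a c b b' d d' : Fin 2) :
    SameMargins (E a b c d + E a b' c d') (E a b c d' + E a b' c d) := by
  constructor <;> intro x y <;> simp only [margA_add, margA_E, margB_add, margB_E] <;> omega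

theorem sameMargins_one_three (b d : Fin 2) :
    SameMargins (E 1 b 0 d + E 0 b 1 d) (E 0 b 0 d + E 1 b 1 d) := by
  constructor <;> intro x y <;> simp only [margA_add, margA_E, margB_add, margB_E] <;>
    fin_cases x <;> fin_cases y <;> simp

theorem sameMargins_quartic_two (b b' d d' d'' d''' : Fin 2) :
    SameMargins (E 1 b 0 d + (E 0 b 1 d' + (E 0 b' 0 d'' + E 1 b' 1 d''')))
      (E 1 b' 0 d + (E 0 b' 1 d' + (E 0 b 0 d'' + E 1 b 1 d'''))) := by
  constructor <;> intro x y <;> simp only [margA_add, margA_E, margB_add, margB_E] <;>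
    fin_cases x <;> fin_cases y <;> simp <;> omega

theorem sameMargins_quartic_four (b b' b'' b''' d d' : Fin 2) :
    SameMargins (E 1 b 0 d + (E 0 b' 1 d + (E 0 b'' 0 d' + E 1 b''' 1 d')))
      (E 1 b 0 d' + (E 0 b' 1 d' + (E 0 b'' 0 d + E 1 b''' 1 d))) := by
  constructor <;> intro x y <;> simp only [margA_add, margA_E, margB_add, margB_E] <;>
    fin_cases x <;> fin_cases y <;> simp <;> omega

theorem E_le {a b c d : Fin 2} (hu : 0 < u ![a, b, c, d]) : E a b c d ≤ u := by
  intro x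
  rw [E, Finsupp.single_apply]
  split_ifs with hx
  · rw [← hx]; exact hu
  · exact Nat.zero_le _

theorem E_add_le {a b c d : Fin 2} (hg : g ≤ u) (h0 : g ![a, b, c, d] = 0)
    (hu : 0 < u ![a, b, c, d]) : E a b c d + g ≤ u :=
  single_add_le hg h0 hu

end Margins

/-! ### Connectivity of the fibers -/

section Connectivity

variable {u v : (Fin 4 → Fin 2) →₀ ℕ}

/-- Names the opposite levels of `b` and `d`, so that later arguments avoid splitting into cases. -/
theorem exists_ne_margins (b d : Fin 2) : ∃ b' d', b' ≠ b ∧ d' ≠ d ∧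
    (∀ (u : (Fin 4 → Fin 2) →₀ ℕ) a c, margA u a b c = u ![a, b, c, d] + u ![a, b, c, d']) ∧
    ∀ (u : (Fin 4 → Fin 2) →₀ ℕ) a c, margB u a c d = u ![a, b, c, d] + u ![a, b', c, d] := by
  have h2 : ∀ x : Fin 2, x = 0 ∨ x = 1 := by decide
  rcases h2 b with rfl | rfl <;> rcases h2 d with rfl | rfl
  · exact ⟨1, 1, by decide, by decide, fun _ _ _ => rfl, fun _ _ _ => rfl⟩
  · exact ⟨1, 0, by decide, by decide, fun _ _ _ => add_comm _ _, fun _ _ _ => rfl⟩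
  · exact ⟨0, 1, by decide, by decide, fun _ _ _ => rfl, fun _ _ _ => add_comm _ _⟩
  · exact ⟨0, 0, by decide, by decide, fun _ _ _ => add_comm _ _, fun _ _ _ => add_comm _ _⟩

/-- A table with positive marginals at `(a, b, c)` and `(a, c, d)` can be moved to one which is
positive at `(a, b, c, d)`, without changing the marginals. -/
theorem exists_pos_of_marg_pos {a b c d : Fin 2} (hA : 0 < margA u a b c)
    (hB : 0 < margB u a c d) : ∃ u', MonRel markovIdeal u u' ∧ margA u' = margA u ∧
      margB u' = margB u ∧ 0 < u' ![a, b, c, d] ∧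
      ∀ a' b' c' d', a ≠ a' → u' ![a', b', c', d'] = u ![a', b', c', d'] := by
  by_cases hu : 0 < u ![a, b, c, d]
  · exact ⟨u, MonRel.refl u, rfl, rfl, hu, fun _ _ _ _ _ => rfl⟩
  obtain ⟨b', d', hb, hd, h1, h2⟩ := exists_ne_margins b d
  rw [h1] at hA
  rw [h2] at hB
  -- The cell (a,b,c,d) is empty, so both positive margins come from cells with an opposite level;
  -- swapping their X4 levels fills it.
  have hle : E a b c d' + E a b' c d ≤ u :=
    E_add_le (E_le (by omega)) (by simp [E_apply, hb]) (by omega)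
  obtain ⟨u', hr, hm⟩ := (monRel_two_four a c b b' d' d).exists_of_le hle
  refine ⟨u', hr, ?_, ?_, ?_, ?_⟩
  · funext x y z
    have := margA_of_move hm x y z
    simp only [margA_add, margA_E] at this
    omega
  · funext x y z
    have := margB_of_move hm x y z
    simp only [margB_add, margB_E] at this
    omega
  · have := hm ![a, b, c, d]
    simp [E_apply, hb, hd] at this
    omega
  · intro x y z t hx
    have := hm ![x, y, z, t]
    simp [E_apply, hx] at this
    omega

/-- The move that increases the marginals at `(0, i, 0)` and at `(0, 0, j)`. -/
theorem exists_move_both {i j : Fin 2} (h1 : 0 < margA u 1 i 0) (h2 : 0 < margA u 0 i 1)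
    (h3 : 0 < margB u 1 0 j) (h4 : 0 < margB u 0 1 j) :
    ∃ u', MonRel markovIdeal u u' ∧ SameMargins u u' ∧
      (∀ k, margA u' 0 k 0 = margA u 0 k 0 + if i = k then 1 else 0) ∧
      ∀ k, margB u' 0 0 k = margB u 0 0 k + if j = k then 1 else 0 := by
  -- The quadric consumes the cells (1,i,0,j) and (0,i,1,j). They are filled in turn; filling the
  -- second only alters cells with X1 = 0, so the first stays positive.
  obtain ⟨u₁, hr₁, hA₁, hB₁, hp₁, -⟩ := exists_pos_of_marg_pos h1 h3
  rw [← hA₁] at h2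
  rw [← hB₁] at h4
  obtain ⟨u₂, hr₂, hA₂, hB₂, hp₂, he⟩ := exists_pos_of_marg_pos h2 h4
  rw [← he _ _ _ _ (by decide)] at hp₁
  obtain ⟨u₃, hr₃, hm⟩ := (monRel_one_three i j).exists_of_le
    (E_add_le (E_le hp₂) (by simp [E_apply]) hp₁)
  have hA := margA_of_move hm
  have hB := margB_of_move hm
  rw [hA₂, hA₁] at hA
  rw [hB₂, hB₁] at hB
  refine ⟨u₃, hr₁.trans (hr₂.trans hr₃), sameMargins_of_move hA hB (sameMargins_one_three i j),
    fun k => ?_, fun k => ?_⟩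
  · simpa [margA_add, margA_E] using hA 0 k 0
  · simpa [margB_add, margB_E] using hB 0 0 k

theorem exists_pos_of_margA_pos {a b c : Fin 2} (h : 0 < margA u a b c) :
    ∃ d, 0 < u ![a, b, c, d] := by
  by_contra! h0
  have := h0 0
  have := h0 1
  simp only [margA] at h
  omega

theorem exists_pos_of_margB_pos {a c d : Fin 2} (h : 0 < margB u a c d) :
    ∃ b, 0 < u ![a, b, c, d] := by
  by_contra! h0
  have := h0 0
  have := h0 1
  simp only [margB] at h
  omega

/-- The move with the levels of X2 interchanged is the same binomial read backwards. -/
theorem monRel_move_two {b b' : Fin 2} (hb : b ≠ b') (d d' d'' d''' : Fin 2) :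
    MonRel markovIdeal (E 1 b 0 d + (E 0 b 1 d' + (E 0 b' 0 d'' + E 1 b' 1 d''')))
      (E 1 b' 0 d + (E 0 b' 1 d' + (E 0 b 0 d'' + E 1 b 1 d'''))) := by
  have h := monRel_quartic_two ![![d'', d'], ![d, d''']]
  have h2 : b = 0 ∧ b' = 1 ∨ b = 1 ∧ b' = 0 := by revert b b'; decide
  rcases h2 with ⟨rfl, rfl⟩ | ⟨rfl, rfl⟩
  · exact h
  · exact h.symm

theorem monRel_move_four {d d' : Fin 2} (hd : d ≠ d') (b b' b'' b''' : Fin 2) :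
    MonRel markovIdeal (E 1 b 0 d + (E 0 b' 1 d + (E 0 b'' 0 d' + E 1 b''' 1 d')))
      (E 1 b 0 d' + (E 0 b' 1 d' + (E 0 b'' 0 d + E 1 b''' 1 d))) := by
  have h := monRel_quartic_four ![![b'', b'], ![b, b''']]
  have h2 : d = 0 ∧ d' = 1 ∨ d = 1 ∧ d' = 0 := by revert d d'; decide
  rcases h2 with ⟨rfl, rfl⟩ | ⟨rfl, rfl⟩
  · exact h
  · exact h.symm

/-- The move that increases the marginal at `(0, i, 0)` and decreases the one at `(0, i', 0)`. -/
theorem exists_move_two {i i' : Fin 2} (hi : i ≠ i') (h1 : 0 < margA u 1 i 0)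
    (h2 : 0 < margA u 0 i 1) (h3 : 0 < margA u 0 i' 0) (h4 : 0 < margA u 1 i' 1) :
    ∃ u', MonRel markovIdeal u u' ∧ SameMargins u u' ∧
      (∀ k, margA u' 0 k 0 + (if i' = k then 1 else 0) =
        margA u 0 k 0 + if i = k then 1 else 0) ∧
      ∀ k, margB u' 0 0 k = margB u 0 0 k := by
  -- The quartic move allows arbitrary X4 levels, so any positive cells over the four margins serve.
  obtain ⟨d, hd⟩ := exists_pos_of_margA_pos h1
  obtain ⟨d', hd'⟩ := exists_pos_of_margA_pos h2
  obtain ⟨d'', hd''⟩ := exists_pos_of_margA_pos h3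
  obtain ⟨d''', hd'''⟩ := exists_pos_of_margA_pos h4
  obtain ⟨u', hr, hm⟩ := (monRel_move_two hi d d' d'' d''').exists_of_le
    (E_add_le (E_add_le (E_add_le (E_le hd''') (by simp [E_apply]) hd'') (by simp [E_apply]) hd')
      (by simp [E_apply, hi.symm]) hd)
  have hA := margA_of_move hm
  have hB := margB_of_move hm
  refine ⟨u', hr, sameMargins_of_move hA hB (sameMargins_quartic_two _ _ _ _ _ _),
    fun k => ?_, fun k => ?_⟩
  · simpa [margA_add, margA_E] using hA 0 k 0
  · simpa [margB_add, margB_E] using hB 0 0 k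

/-- The move that increases the marginal at `(0, 0, j)` and decreases the one at `(0, 0, j')`. -/
theorem exists_move_four {j j' : Fin 2} (hj : j ≠ j') (h1 : 0 < margB u 1 0 j)
    (h2 : 0 < margB u 0 1 j) (h3 : 0 < margB u 0 0 j') (h4 : 0 < margB u 1 1 j') :
    ∃ u', MonRel markovIdeal u u' ∧ SameMargins u u' ∧
      (∀ k, margA u' 0 k 0 = margA u 0 k 0) ∧
      ∀ k, margB u' 0 0 k + (if j' = k then 1 else 0) =
        margB u 0 0 k + if j = k then 1 else 0 := by
  obtain ⟨b, hb⟩ := exists_pos_of_margB_pos h1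
  obtain ⟨b', hb'⟩ := exists_pos_of_margB_pos h2
  obtain ⟨b'', hb''⟩ := exists_pos_of_margB_pos h3
  obtain ⟨b''', hb'''⟩ := exists_pos_of_margB_pos h4
  obtain ⟨u', hr, hm⟩ := (monRel_move_four hj b b' b'' b''').exists_of_le
    (E_add_le (E_add_le (E_add_le (E_le hb''') (by simp [E_apply]) hb'') (by simp [E_apply]) hb')
      (by simp [E_apply, hj.symm]) hb)
  have hA := margA_of_move hm
  have hB := margB_of_move hm
  refine ⟨u', hr, sameMargins_of_move hA hB (sameMargins_quartic_four _ _ _ _ _ _),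
    fun k => ?_, fun k => ?_⟩
  · simpa [margA_add, margA_E] using hA 0 k 0
  · simpa [margB_add, margB_E] using hB 0 0 k

theorem sum_dist_lt {f f' g : Fin 2 → Fin 2 → ℕ} {a c : Fin 2} (h : f a c < g a c)
    (hf : ∀ x z, f' x z = f x z + if a = x ∧ c = z then 1 else 0) :
    (∑ x, ∑ z, (f' x z - g x z + (g x z - f' x z))) <
      ∑ x, ∑ z, (f x z - g x z + (g x z - f x z)) := by
  have h2 : ∀ i : Fin 2, i = 0 ∨ i = 1 := by decide
  simp only [Fin.sum_univ_two, hf]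
  rcases h2 a with rfl | rfl <;> rcases h2 c with rfl | rfl <;> simp <;> omega

/-- Tables with the same marginals on `{1, 2, 3}` and on `{1, 3, 4}` are connected. -/
theorem monRel_of_marg_eq (n : ℕ) : ∀ u v : (Fin 4 → Fin 2) →₀ ℕ, margA u = margA v →
    margB u = margB v →
    (∑ a, ∑ c, (u ![a, 0, c, 0] - v ![a, 0, c, 0] + (v ![a, 0, c, 0] - u ![a, 0, c, 0]))) = n →
    MonRel markovIdeal u v := by
  induction n using Nat.strong_induction_on with
  | _ n ih =>
    have key : ∀ u v : (Fin 4 → Fin 2) →₀ ℕ, margA u = margA v → margB u = margB v →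
        (∑ a, ∑ c, (u ![a, 0, c, 0] - v ![a, 0, c, 0] + (v ![a, 0, c, 0] - u ![a, 0, c, 0]))) = n →
        (∃ a c, u ![a, 0, c, 0] < v ![a, 0, c, 0]) → MonRel markovIdeal u v := by
      rintro u v hA hB hn ⟨a, c, hlt⟩
      have h1 := congrFun (congrFun (congrFun hA a) 0) c
      have h2 := congrFun (congrFun (congrFun hB a) c) 0
      simp only [margA, margB] at h1 h2
      -- In a 2×2 slice with fixed row and column sums, a deficit at (0,0) forces a surplus at (0,1)
      -- and (1,0), which are therefore positive.
      have hle : E a 0 c 1 + E a 1 c 0 ≤ u :=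
        E_add_le (E_le (by omega)) (by simp [E_apply]) (by omega)
      obtain ⟨u', hr, hm⟩ := (monRel_two_four a c 0 1 1 0).exists_of_le hle
      have hA' : margA u' = margA u := by
        funext x y z
        have := margA_of_move hm x y z
        simp only [margA_add, margA_E] at this
        omega
      have hB' : margB u' = margB u := by
        funext x y z
        have := margB_of_move hm x y z
        simp only [margB_add, margB_E] at this
        omega
      refine hr.trans (ih _ ?_ u' v (hA'.trans hA) (hB'.trans hB) rfl)
      rw [← hn]
      refine sum_dist_lt (f := fun a c => u ![a, 0, c, 0]) (f' := fun a c => u' ![a, 0, c, 0])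
        (g := fun a c => v ![a, 0, c, 0]) hlt fun x z => ?_
      simpa [E_apply] using hm ![x, 0, z, 0]
    intro u v hA hB hn
    by_cases h1 : ∃ a c, u ![a, 0, c, 0] < v ![a, 0, c, 0]
    · exact key u v hA hB hn h1
    by_cases h2 : ∃ a c, v ![a, 0, c, 0] < u ![a, 0, c, 0]
    · refine (key v u hA.symm hB.symm ?_ h2).symm
      rw [← hn]
      simp only [add_comm]
    push Not at h1 h2
    -- One entry of each 2×2 slice together with its row and column sums determines the slice.
    have huv : u = v := by
      ext x
      have hx : x = ![x 0, x 1, x 2, x 3] := by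
        funext i
        fin_cases i <;> rfl
      rw [hx]
      have e := le_antisymm (h2 (x 0) (x 2)) (h1 (x 0) (x 2))
      have e1 := congrFun (congrFun (congrFun hA (x 0)) 0) (x 2)
      have e2 := congrFun (congrFun (congrFun hA (x 0)) 1) (x 2)
      have e3 := congrFun (congrFun (congrFun hB (x 0)) (x 2)) 0
      have hbd : ∀ b d : Fin 2, (b = 0 ∨ b = 1) ∧ (d = 0 ∨ d = 1) := by decide
      simp only [margA, margB] at e1 e2 e3
      rcases hbd (x 1) (x 3) with ⟨h | h, h' | h'⟩ <;> rw [h, h'] <;> omega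
    rw [huv]
    exact MonRel.refl v

/-- Both sides are the {1,3} margin; this is the only coupling between the two families of free
parameters. -/
theorem margA_zero_zero_add (u : (Fin 4 → Fin 2) →₀ ℕ) (a c : Fin 2) :
    margA u a 0 c + margA u a 1 c = margB u a c 0 + margB u a c 1 := by
  simp only [margA, margB]
  ring

/-- The distance of two tables with the same marginals on the edges, up to tables with the same
marginals on `{1, 2, 3}` and on `{1, 3, 4}`. -/
def margDist (u v : (Fin 4 → Fin 2) →₀ ℕ) : ℕ :=
  ∑ i, (margA u 0 i 0 - margA v 0 i 0 + (margA v 0 i 0 - margA u 0 i 0) +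
    (margB u 0 0 i - margB v 0 0 i + (margB v 0 0 i - margB u 0 0 i)))

theorem margDist_comm (u v : (Fin 4 → Fin 2) →₀ ℕ) : margDist u v = margDist v u := by
  simp only [margDist, add_comm]

theorem margDist_lt_of_both {u u' v : (Fin 4 → Fin 2) →₀ ℕ} {i j : Fin 2}
    (hi : margA u 0 i 0 < margA v 0 i 0) (hj : margB u 0 0 j < margB v 0 0 j)
    (hA : ∀ k, margA u' 0 k 0 = margA u 0 k 0 + if i = k then 1 else 0)
    (hB : ∀ k, margB u' 0 0 k = margB u 0 0 k + if j = k then 1 else 0) :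
    margDist u' v < margDist u v := by
  have h2 : ∀ i : Fin 2, i = 0 ∨ i = 1 := by decide
  simp only [margDist, Fin.sum_univ_two, hA, hB]
  rcases h2 i with rfl | rfl <;> rcases h2 j with rfl | rfl <;> simp <;> omega

theorem margDist_lt_of_two {u u' v : (Fin 4 → Fin 2) →₀ ℕ} {i i' : Fin 2} (hne : i ≠ i')
    (hi : margA u 0 i 0 < margA v 0 i 0) (hi' : margA v 0 i' 0 < margA u 0 i' 0)
    (hA : ∀ k, margA u' 0 k 0 + (if i' = k then 1 else 0) =
      margA u 0 k 0 + if i = k then 1 else 0)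
    (hB : ∀ k, margB u' 0 0 k = margB u 0 0 k) : margDist u' v < margDist u v := by
  have h2 : ∀ i : Fin 2, i = 0 ∨ i = 1 := by decide
  have hA0 := hA 0
  have hA1 := hA 1
  simp only [margDist, Fin.sum_univ_two, hB]
  rcases h2 i with rfl | rfl <;> rcases h2 i' with rfl | rfl <;> simp at hne hA0 hA1 <;> omega

theorem margDist_lt_of_four {u u' v : (Fin 4 → Fin 2) →₀ ℕ} {j j' : Fin 2} (hne : j ≠ j')
    (hj : margB u 0 0 j < margB v 0 0 j) (hj' : margB v 0 0 j' < margB u 0 0 j')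
    (hA : ∀ k, margA u' 0 k 0 = margA u 0 k 0)
    (hB : ∀ k, margB u' 0 0 k + (if j' = k then 1 else 0) =
      margB u 0 0 k + if j = k then 1 else 0) : margDist u' v < margDist u v := by
  have h2 : ∀ i : Fin 2, i = 0 ∨ i = 1 := by decide
  have hB0 := hB 0
  have hB1 := hB 1
  simp only [margDist, Fin.sum_univ_two, hA]
  rcases h2 j with rfl | rfl <;> rcases h2 j' with rfl | rfl <;> simp at hne hB0 hB1 <;> omega

/-- The differences f' - f and g' - g have the same sum. By `c3` and `c4` neither takes both signs.
A nonzero common sum would give both a nonzero entry of the same sign, against `c1` or `c2`; a zero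
sum makes both vanish. -/
theorem eq_of_no_move {f f' g g' : Fin 2 → ℕ} (hf : f 0 + f 1 = g 0 + g 1)
    (hf' : f' 0 + f' 1 = g' 0 + g' 1) (c1 : ¬ ∃ i j, f i < f' i ∧ g j < g' j)
    (c2 : ¬ ∃ i j, f' i < f i ∧ g' j < g j)
    (c3 : ¬ ∃ i i', i ≠ i' ∧ f i < f' i ∧ f' i' < f i')
    (c4 : ¬ ∃ j j', j ≠ j' ∧ g j < g' j ∧ g' j' < g j') :
    (∀ i, f i = f' i) ∧ ∀ j, g j = g' j := by
  simp only [Fin.exists_fin_two, Fin.forall_fin_two] at *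
  simp at c3 c4
  omega

theorem monRel_of_sameMargins_of_dist (n : ℕ) : ∀ u v : (Fin 4 → Fin 2) →₀ ℕ, SameMargins u v →
    margDist u v = n → MonRel markovIdeal u v := by
  induction n using Nat.strong_induction_on with
  | _ n ih =>
    have up : ∀ u v : (Fin 4 → Fin 2) →₀ ℕ, SameMargins u v → margDist u v = n →
        (∃ i j, margA u 0 i 0 < margA v 0 i 0 ∧ margB u 0 0 j < margB v 0 0 j) →
        MonRel markovIdeal u v := by
      rintro u v hs hn ⟨i, j, hi, hj⟩
      -- Where a margin of `u` falls short of that of `v`, equality of edge margins makes its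
      -- neighbours exceed those of `v`. This gives the positivity the move needs; the later cases
      -- argue likewise.
      have e1 := hs.m23 i 0
      have e2 := hs.m12 0 i
      have e3 := hs.m34 0 j
      have e4 := hs.m14 0 j
      obtain ⟨u', hr, hs', hA, hB⟩ := exists_move_both (u := u) (i := i) (j := j) (by omega)
        (by omega) (by omega) (by omega)
      exact hr.trans (ih _ (hn ▸ margDist_lt_of_both hi hj hA hB) u' v (hs'.symm.trans hs) rfl)
    intro u v hs hn
    by_cases c1 : ∃ i j, margA u 0 i 0 < margA v 0 i 0 ∧ margB u 0 0 j < margB v 0 0 j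
    · exact up u v hs hn c1
    by_cases c2 : ∃ i j, margA v 0 i 0 < margA u 0 i 0 ∧ margB v 0 0 j < margB u 0 0 j
    · exact (up v u hs.symm ((margDist_comm v u).trans hn) c2).symm
    by_cases c3 : ∃ i i', i ≠ i' ∧ margA u 0 i 0 < margA v 0 i 0 ∧ margA v 0 i' 0 < margA u 0 i' 0
    · obtain ⟨i, i', hne, hi, hi'⟩ := c3
      have e1 := hs.m23 i 0
      have e2 := hs.m12 0 i
      have e3 := hs.m23 i' 0
      have e4 := hs.m12 1 i'
      obtain ⟨u', hr, hs', hA, hB⟩ := exists_move_two (u := u) hne (by omega)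
        (by omega) (by omega) (by omega)
      exact hr.trans (ih _ (hn ▸ margDist_lt_of_two hne hi hi' hA hB) u' v
        (hs'.symm.trans hs) rfl)
    by_cases c4 : ∃ j j', j ≠ j' ∧ margB u 0 0 j < margB v 0 0 j ∧ margB v 0 0 j' < margB u 0 0 j'
    · obtain ⟨j, j', hne, hj, hj'⟩ := c4
      have e1 := hs.m34 0 j
      have e2 := hs.m14 0 j
      have e3 := hs.m34 0 j'
      have e4 := hs.m14 1 j'
      obtain ⟨u', hr, hs', hA, hB⟩ := exists_move_four (u := u) hne (by omega)
        (by omega) (by omega) (by omega)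
      exact hr.trans (ih _ (hn ▸ margDist_lt_of_four hne hj hj' hA hB) u' v
        (hs'.symm.trans hs) rfl)
    have hAB := eq_of_no_move (f := fun i => margA u 0 i 0) (f' := fun i => margA v 0 i 0)
      (g := fun j => margB u 0 0 j) (g' := fun j => margB v 0 0 j)
      (margA_zero_zero_add u 0 0) (margA_zero_zero_add v 0 0) c1 c2 c3 c4
    clear c1 c2 c3 c4 up ih
    have h2 : ∀ i : Fin 2, i = 0 ∨ i = 1 := by decide
    -- For fixed X2 the {1,2,3} margin is a 2×2 table in (X1, X3) with known edge sums, so its entry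
    -- at (0,0) determines it; likewise for {1,3,4} with X4 fixed.
    refine monRel_of_marg_eq _ u v ?_ ?_ rfl
    · funext a b c
      have e0 := hAB.1 b
      have e1 := hs.m23 b 0
      have e2 := hs.m12 0 b
      have e3 := hs.m12 1 b
      rcases h2 a with rfl | rfl <;> rcases h2 c with rfl | rfl <;> omega
    · funext a c d
      have e0 := hAB.2 d
      have e1 := hs.m34 0 d
      have e2 := hs.m14 0 d
      have e3 := hs.m14 1 d
      rcases h2 a with rfl | rfl <;> rcases h2 c with rfl | rfl <;> omega

theorem monRel_of_sameMargins (h : SameMargins u v) : MonRel markovIdeal u v :=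
  monRel_of_sameMargins_of_dist _ u v h rfl

end Connectivity

/-! ### The toric ideal of the four-cycle -/

section ToricIdeal

theorem monRel_toricIdeal {d m : Type*} [Fintype m] {A : Matrix d m ℕ} {u v : m →₀ ℕ}
    (h : A.mulVec u = A.mulVec v) : MonRel (toricIdeal A) u v :=
  Ideal.subset_span ⟨u, v, h, rfl⟩

theorem monRel_fourCycle {u v : (Fin 4 → Fin 2) →₀ ℕ} (h : SameMargins u v) :
    MonRel (toricIdeal fourCycleMatrix) u v :=
  monRel_toricIdeal ((fourCycleMatrix_mulVec_eq_iff u v).2 h)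

theorem cross_one_three_mem_toricIdeal (b d : Fin 2) :
    p 1 b 0 d * p 0 b 1 d - p 0 b 0 d * p 1 b 1 d ∈ toricIdeal fourCycleMatrix := by
  have h := monRel_fourCycle (sameMargins_one_three b d)
  rwa [E, E, E, E, monRel_two] at h

theorem cross_two_four_mem_toricIdeal (a c : Fin 2) :
    p a 0 c 1 * p a 1 c 0 - p a 0 c 0 * p a 1 c 1 ∈ toricIdeal fourCycleMatrix := by
  have h := monRel_fourCycle (sameMargins_two_four a c 0 1 1 0)
  rwa [E, E, E, E, monRel_two] at h

theorem quartic_two_mem_toricIdeal (d d' d'' d''' : Fin 2) :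
    p 1 0 0 d * p 0 0 1 d' * p 0 1 0 d'' * p 1 1 1 d''' -
      p 1 1 0 d * p 0 1 1 d' * p 0 0 0 d'' * p 1 0 1 d''' ∈ toricIdeal fourCycleMatrix := by
  have h := monRel_fourCycle (sameMargins_quartic_two 0 1 d d' d'' d''')
  simp only [E, monRel_four] at h
  exact h

theorem quartic_four_mem_toricIdeal (b b' b'' b''' : Fin 2) :
    p 1 b 0 0 * p 0 b' 1 0 * p 0 b'' 0 1 * p 1 b''' 1 1 -
      p 1 b 0 1 * p 0 b' 1 1 * p 0 b'' 0 0 * p 1 b''' 1 0 ∈ toricIdeal fourCycleMatrix := by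
  have h := monRel_fourCycle (sameMargins_quartic_four b b' b'' b''' 0 1)
  simp only [E, monRel_four] at h
  exact h

theorem quadrics_subset_toricIdeal : quadrics ⊆ toricIdeal fourCycleMatrix := by
  rintro f (rfl | rfl | rfl | rfl | rfl | rfl | rfl | rfl)
  · exact cross_two_four_mem_toricIdeal 1 1
  · exact mem_of_eq_or_eq_neg (cross_one_three_mem_toricIdeal 1 1) (by left; ring)
  · exact cross_two_four_mem_toricIdeal 1 0
  · exact mem_of_eq_or_eq_neg (cross_one_three_mem_toricIdeal 1 0) (by left; ring)
  · exact mem_of_eq_or_eq_neg (cross_one_three_mem_toricIdeal 0 1) (by left; ring)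
  · exact cross_two_four_mem_toricIdeal 0 1
  · exact cross_two_four_mem_toricIdeal 0 0
  · exact mem_of_eq_or_eq_neg (cross_one_three_mem_toricIdeal 0 0) (by left; ring)

theorem quartics_subset_toricIdeal : quartics ⊆ toricIdeal fourCycleMatrix := by
  rintro f (rfl | rfl | rfl | rfl | rfl | rfl | rfl | rfl)
  · exact mem_of_eq_or_eq_neg (quartic_four_mem_toricIdeal 0 1 1 0) (by right; rw [f12diff]; ring)
  · exact mem_of_eq_or_eq_neg (quartic_four_mem_toricIdeal 1 0 1 0) (by left; rw [f23diff]; ring)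
  · exact mem_of_eq_or_eq_neg (quartic_two_mem_toricIdeal 1 0 1 0) (by right; rw [f34diff]; ring)
  · exact mem_of_eq_or_eq_neg (quartic_two_mem_toricIdeal 0 1 1 0) (by right; rw [f14diff]; ring)
  · exact mem_of_eq_or_eq_neg (quartic_four_mem_toricIdeal 1 0 0 1) (by right; rw [f12same]; ring)
  · exact mem_of_eq_or_eq_neg (quartic_four_mem_toricIdeal 0 1 0 1) (by right; rw [f23same]; ring)
  · exact mem_of_eq_or_eq_neg (quartic_two_mem_toricIdeal 0 1 0 1) (by right; rw [f34same]; ring)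
  · exact mem_of_eq_or_eq_neg (quartic_two_mem_toricIdeal 1 0 0 1) (by right; rw [f14same]; ring)

theorem toricIdeal_fourCycle : toricIdeal fourCycleMatrix = markovIdeal := by
  apply le_antisymm
  · refine Ideal.span_le.2 ?_
    rintro f ⟨u, v, h, rfl⟩
    exact monRel_of_sameMargins ((fourCycleMatrix_mulVec_eq_iff u v).1 h)
  · exact sup_le (Ideal.span_le.2 quadrics_subset_toricIdeal)
      (Ideal.span_le.2 quartics_subset_toricIdeal)

end ToricIdeal

/-! ### Nonnegative points of a toric variety and limits of factoring distributions -/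

section NonnegativeToricVariety

variable {d m : Type*}

/-- The real span of the rows of `A`. -/
def rowSpan (A : Matrix d m ℕ) : Submodule ℝ (m → ℝ) :=
  Submodule.span ℝ (Set.range fun i j => (A i j : ℝ))

theorem row_mem_rowSpan (A : Matrix d m ℕ) (i : d) : (fun j => (A i j : ℝ)) ∈ rowSpan A :=
  Submodule.subset_span ⟨i, rfl⟩

theorem eval_monomial_eq_prod [Fintype m] (u : m →₀ ℕ) (P : m → ℝ) :
    eval P (monomial u (1 : ℝ)) = ∏ j, P j ^ u j := by
  rw [eval_monomial, one_mul, Finsupp.prod_fintype]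
  simp

variable {A : Matrix d m ℕ} {P : m → ℝ}

/-- A nonnegative point of the toric variety satisfies the logarithmic form of every integer
relation among the columns of `A` that belong to its support. -/
theorem sum_mul_log_eq_zero [Fintype m]
    (hP : ∀ u v : m → ℕ, A.mulVec u = A.mulVec v → ∏ j, P j ^ u j = ∏ j, P j ^ v j)
    (z : m → ℤ) (hz0 : ∀ j, P j = 0 → z j = 0) (hz : ∀ i, ∑ j, (A i j : ℤ) * z j = 0) :
    ∑ j, z j * Real.log (P j) = 0 := by
  have hzz : ∀ j, ((z j).toNat : ℤ) - ((-z j).toNat : ℤ) = z j := fun j => by omega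
  -- The positive and negative parts of `z` have the same image under `A`, so they give a binomial
  -- relation.
  have h := hP (fun j => (z j).toNat) (fun j => (-z j).toNat) (by
    funext i
    have hi : ∑ j, (A i j : ℤ) * ((z j).toNat : ℤ) - ∑ j, (A i j : ℤ) * ((-z j).toNat : ℤ) = 0 := by
      rw [← Finset.sum_sub_distrib, ← hz i]
      exact Finset.sum_congr rfl fun j _ => by rw [← mul_sub, hzz]
    simp only [Matrix.mulVec, dotProduct]
    exact_mod_cast sub_eq_zero.1 hi)
  -- Coordinates where `P` is zero carry exponent 0, so every factor is nonzero and the logarithm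
  -- splits.
  have hne : ∀ w : m → ℕ, (∀ j, P j = 0 → w j = 0) → ∀ j ∈ Finset.univ, P j ^ w j ≠ 0 := by
    intro w hw j _
    by_cases hj : P j = 0
    · simp [hw j hj]
    · exact pow_ne_zero _ hj
  have h' := congrArg Real.log h
  rw [Real.log_prod (hne _ fun j hj => by simp [hz0 j hj]),
    Real.log_prod (hne _ fun j hj => by simp [hz0 j hj])] at h'
  simp only [Real.log_pow] at h'
  rw [← sub_eq_zero, ← Finset.sum_sub_distrib] at h'
  rw [← h']
  refine Finset.sum_congr rfl fun j _ => ?_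
  rw [← sub_mul]
  congr 1
  exact_mod_cast (hzz j).symm

variable [Fintype d]

theorem prod_monomialMap_pow [Fintype m] (A : Matrix d m ℕ) (t : d → ℝ) (u : m → ℕ) :
    ∏ j, monomialMap A t j ^ u j = ∏ i, t i ^ A.mulVec u i := by
  simp only [monomialMap, ← Finset.prod_pow, ← pow_mul]
  rw [Finset.prod_comm]
  simp only [Finset.prod_pow_eq_pow_sum]
  rfl

theorem Factors.eval_eq_zero [Fintype m] (hP : Factors A P) {f : MvPolynomial m ℝ}
    (hf : f ∈ toricIdeal A) : eval P f = 0 := by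
  obtain ⟨t, -, rfl⟩ := hP
  have hle : toricIdeal A ≤ RingHom.ker (eval (monomialMap A t)) := by
    refine Ideal.span_le.2 ?_
    rintro _ ⟨u, v, huv, rfl⟩
    rw [SetLike.mem_coe, RingHom.mem_ker, map_sub, eval_monomial_eq_prod, eval_monomial_eq_prod,
      prod_monomialMap_pow, prod_monomialMap_pow, huv, sub_self]
  exact hle hf

theorem IsLimitOfFactoring.eval_eq_zero [Fintype m] (hP : IsLimitOfFactoring A P)
    {f : MvPolynomial m ℝ} (hf : f ∈ toricIdeal A) : eval P f = 0 := by
  obtain ⟨Q, hQ, hlim⟩ := hP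
  have h := ((MvPolynomial.continuous_eval f).tendsto P).comp hlim
  refine tendsto_nhds_unique h ?_
  refine tendsto_const_nhds.congr fun n => ?_
  exact ((hQ n).2.eval_eq_zero hf).symm

theorem factors_exp {θ : m → ℝ} (hθ : θ ∈ rowSpan A) : Factors A fun j => Real.exp (θ j) := by
  obtain ⟨c, rfl⟩ := (Submodule.mem_span_range_iff_exists_fun ℝ).1 hθ
  refine ⟨fun i => Real.exp (c i), fun i => (Real.exp_pos _).le, ?_⟩
  funext j
  simp only [monomialMap, ← Real.exp_nat_mul, ← Real.exp_sum, Finset.sum_apply, Pi.smul_apply,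
    smul_eq_mul, mul_comm]

variable [Fintype m]

/-- The logarithm of a nonnegative point of the toric variety agrees on its support with an element
of the row span. -/
theorem exists_mem_rowSpan_exp_eq (hP0 : ∀ j, 0 ≤ P j)
    (hP : ∀ u v : m → ℕ, A.mulVec u = A.mulVec v → ∏ j, P j ^ u j = ∏ j, P j ^ v j) :
    ∃ θ ∈ rowSpan A, ∀ j, P j ≠ 0 → Real.exp (θ j) = P j := by
  classical
  -- Binomials only express integer relations, so the linear algebra is done over ℚ, with the
  -- columns off the support set to zero. The goal is to factor the functional `f`, given by the
  -- logarithms, through `M`.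
  set col : m → d → ℚ := fun j i => if P j = 0 then 0 else (A i j : ℚ) with hcol
  let M : (m → ℚ) →ₗ[ℚ] (d → ℚ) := Fintype.linearCombination ℚ col
  let f : (m → ℚ) →ₗ[ℚ] ℝ := Fintype.linearCombination ℚ fun j => Real.log (P j)
  have hker : LinearMap.ker M ≤ LinearMap.ker f := by
    intro c hc
    rw [LinearMap.mem_ker] at hc ⊢
    -- Clearing denominators turns a rational kernel vector into an integer relation.
    obtain ⟨b, hb⟩ := IsLocalization.exist_integer_multiples_of_finite (nonZeroDivisors ℤ) c
    choose z hz using hb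
    have hb0 : ((b : ℤ) : ℝ) ≠ 0 := by exact_mod_cast nonZeroDivisors.coe_ne_zero b
    have hz' : ∀ j, (z j : ℚ) = (b : ℤ) * c j := fun j => by simpa using hz j
    have hlog := sum_mul_log_eq_zero hP (fun j => if P j = 0 then 0 else z j)
      (fun j hj => by simp [hj]) (fun i => by
        have hi := congrFun hc i
        simp only [M, Fintype.linearCombination_apply, Finset.sum_apply, Pi.smul_apply,
          smul_eq_mul, Pi.zero_apply] at hi
        have : ((∑ j, (A i j : ℤ) * (if P j = 0 then 0 else z j) : ℤ) : ℚ) = 0 := by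
          rw [← mul_zero ((b : ℤ) : ℚ), ← hi, Finset.mul_sum]
          push_cast
          refine Finset.sum_congr rfl fun j _ => ?_
          simp only [hcol]
          split_ifs
          · simp
          · rw [hz' j]; ring
        exact_mod_cast this)
    have hbf : ((b : ℤ) : ℝ) * f c = 0 := by
      rw [← hlog, Fintype.linearCombination_apply, Finset.mul_sum]
      refine Finset.sum_congr rfl fun j _ => ?_
      split_ifs with hj
      -- Off the support this uses the convention `Real.log 0 = 0`.
      · simp [hj]
      · have hj' : (z j : ℝ) = (b : ℤ) * (c j : ℝ) := by
          exact_mod_cast congrArg (Rat.cast (K := ℝ)) (hz' j)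
        rw [hj', Rat.smul_def]
        ring
    exact (mul_eq_zero.1 hbf).resolve_left hb0
  obtain ⟨g, hg⟩ : ∃ g : (d → ℚ) →ₗ[ℚ] ℝ, g ∘ₗ M = f := by
    -- `f` descends to the quotient by the kernel of `M`, hence to the range of `M`, and then
    -- extends to the whole space.
    obtain ⟨g, hg⟩ := LinearMap.exists_extend
      ((LinearMap.ker M).liftQ f hker ∘ₗ M.quotKerEquivRange.symm.toLinearMap)
    refine ⟨g, LinearMap.ext fun c => ?_⟩
    have := LinearMap.congr_fun hg ⟨M c, LinearMap.mem_range_self M c⟩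
    simp only [LinearMap.comp_apply, Submodule.subtype_apply] at this
    rw [LinearMap.comp_apply, this]
    have h2 : M.quotKerEquivRange.symm ⟨M c, LinearMap.mem_range_self M c⟩ =
        (LinearMap.ker M).mkQ c := by
      rw [LinearEquiv.symm_apply_eq]
      rfl
    simp [h2]
  -- The values of `g` on the standard basis are the real coefficients of the rows.
  refine ⟨∑ i, g (Pi.single i 1) • fun j => (A i j : ℝ),
    Submodule.sum_mem _ fun i _ => Submodule.smul_mem _ _ (row_mem_rowSpan A i), fun j hj => ?_⟩
  have hfj : f (Pi.single j 1) = Real.log (P j) := by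
    simp [f, Fintype.linearCombination_apply_single]
  have hMj : M (Pi.single j 1) = ∑ i, (A i j : ℚ) • Pi.single i (1 : ℚ) := by
    funext k
    simp [M, Fintype.linearCombination_apply_single, hcol, hj, Finset.sum_apply, Pi.single_apply]
  have hsum : (∑ i, g (Pi.single i 1) • fun j => (A i j : ℝ)) j = Real.log (P j) := by
    rw [← hfj, ← hg, LinearMap.comp_apply, hMj, map_sum, Finset.sum_apply]
    refine Finset.sum_congr rfl fun i _ => ?_
    rw [map_smul, Rat.smul_def, Pi.smul_apply, smul_eq_mul, mul_comm]
    simp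
  rw [hsum, Real.exp_log (lt_of_le_of_ne (hP0 j) (Ne.symm hj))]

/-- A probability distribution on a face of the model, which is log-linear on the face, is a limit
of log-linear distributions. -/
theorem isLimitOfFactoring_of_face (hP : P ∈ stdSimplex ℝ m) {θ ω : m → ℝ}
    (h1 : (fun _ => 1) ∈ rowSpan A) (hθ : θ ∈ rowSpan A) (hω : ω ∈ rowSpan A)
    (hθP : ∀ j, P j ≠ 0 → Real.exp (θ j) = P j) (hω0 : ∀ j, P j ≠ 0 → ω j = 0)
    (hωpos : ∀ j, P j = 0 → 0 < ω j) : IsLimitOfFactoring A P := by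
  have hm : Nonempty m := by
    by_contra hm
    rw [not_nonempty_iff] at hm
    simpa using hP.2
  -- The penalty n·ω kills the coordinates off the support and leaves the others equal to `P`; in
  -- particular the total mass tends to 1.
  let R : ℕ → m → ℝ := fun n j => Real.exp (θ j - n * ω j)
  have hZ : ∀ n, 0 < ∑ j, R n j := fun n =>
    Finset.sum_pos (fun j _ => Real.exp_pos _) Finset.univ_nonempty
  have hR : ∀ j, Filter.Tendsto (fun n => R n j) Filter.atTop (nhds (P j)) := by
    intro j
    by_cases hj : P j = 0
    · rw [hj]
      refine Real.tendsto_exp_atBot.comp (Filter.tendsto_atBot_add_const_left _ _ ?_)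
      exact Filter.tendsto_neg_atTop_atBot.comp
        (tendsto_natCast_atTop_atTop.atTop_mul_const (hωpos j hj))
    · simp only [R, hω0 j hj, mul_zero, sub_zero, hθP j hj]
      exact tendsto_const_nhds
  have hZlim : Filter.Tendsto (fun n => ∑ j, R n j) Filter.atTop (nhds 1) := by
    rw [← hP.2]
    exact tendsto_finsetSum _ fun j _ => hR j
  refine ⟨fun n j => R n j / ∑ k, R n k, fun n => ⟨⟨fun j => ?_, ?_⟩, ?_⟩, ?_⟩
  · exact div_nonneg (Real.exp_pos _).le (hZ n).le
  · rw [← Finset.sum_div, div_self (hZ n).ne']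
  · have hmem : θ - (n : ℝ) • ω - Real.log (∑ k, R n k) • (fun _ => (1 : ℝ)) ∈ rowSpan A :=
      Submodule.sub_mem _ (Submodule.sub_mem _ hθ (Submodule.smul_mem _ _ hω))
        (Submodule.smul_mem _ _ h1)
    convert factors_exp hmem using 2 with j
    simp only [Pi.sub_apply, Pi.smul_apply, smul_eq_mul, mul_one]
    rw [Real.exp_sub _ (Real.log _), Real.exp_log (hZ n)]
  · rw [tendsto_pi_nhds]
    intro j
    have h := (hR j).div hZlim one_ne_zero
    rw [div_one] at h
    exact h

end NonnegativeToricVariety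

/-! ### Supports are cut out by faces of the marginal polytope -/

section Faces

set_option synthInstance.maxHeartbeats 400000 in
set_option synthInstance.maxSize 4000 in
set_option maxRecDepth 10000 in
-- An exhaustive check over the fifteen cells other than 0000, the constant `false` standing for
-- that cell. Each hypothesis is placed as soon as its cells are quantified, so inconsistent
-- branches are pruned early. The first four alternatives say that an edge margin at 00 is empty;
-- the last four are the zero sets of the cycle inequalities that are positive at 0000.
theorem support_subset_face_bool :
    ∀ s0001 s0100 s0101 : Bool, (s0001 && s0100) = (false && s0101) →
    ∀ s1000 s1001 s1100 s1101 : Bool, (s1001 && s1100) = (s1000 && s1101) →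
    ∀ s0010 s0011 s0110 s0111 : Bool, (s0011 && s0110) = (s0010 && s0111) →
    ∀ s1010 : Bool, (s0010 && s1000) = (false && s1010) →
    ∀ s1011 : Bool, (s0011 && s1001) = (s0001 && s1011) →
      (s0100 && s0111 && s1001 && s1010) = (s0101 && s0110 && s1000 && s1011) →
      (s0010 && s0101 && s1011 && s1100) = (s0011 && s0100 && s1010 && s1101) →
    ∀ s1110 : Bool, (s0110 && s1100) = (s0100 && s1110) →
      (s0001 && s0110 && s1010 && s1101) = (s0010 && s0101 && s1001 && s1110) →
      (s0001 && s0111 && s1010 && s1100) = (s0011 && s0101 && s1000 && s1110) →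
    ∀ s1111 : Bool, (s1011 && s1110) = (s1010 && s1111) → (s0111 && s1101) = (s0101 && s1111) →
      (false && s0011 && s1101 && s1110) = (s0001 && s0010 && s1100 && s1111) →
      (false && s0111 && s1001 && s1110) = (s0001 && s0110 && s1000 && s1111) →
      (false && s0111 && s1011 && s1100) = (s0011 && s0100 && s1000 && s1111) →
      (false && s0110 && s1011 && s1101) = (s0010 && s0100 && s1001 && s1111) →
      ((!s0001 && !s0010 && !s0011) ||
      (!s0001 && !s1000 && !s1001) ||
      (!s0100 && !s1000 && !s1100) ||
      (!s0010 && !s0100 && !s0110) ||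
      (!s0100 && !s0110 && !s0111 && !s1000 && !s1001 && !s1011 && !s1111) ||
      (!s0010 && !s0011 && !s0100 && !s1011 && !s1100 && !s1101 && !s1111) ||
      (!s0001 && !s0010 && !s0110 && !s1001 && !s1101 && !s1110 && !s1111) ||
      (!s0001 && !s0011 && !s0111 && !s1000 && !s1100 && !s1110 && !s1111)) = true := by
  decide +kernel

/-- The relations that the support of a nonnegative point of the toric variety of the four-cycle
satisfies. -/
structure IsToricSupport (s : Fin 2 → Fin 2 → Fin 2 → Fin 2 → Bool) : Prop where
  h13 : ∀ a a' b c c' d, (s a b c d && s a' b c' d) = (s a b c' d && s a' b c d)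
  h24 : ∀ a b b' c d d', (s a b c d && s a b' c d') = (s a b c d' && s a b' c d)
  h12 : ∀ a a' b b' c c' d d',
    (s a b c d && s a' b' c' d && s a' b' c d' && s a b c' d') =
      (s a b c d' && s a' b' c' d' && s a' b' c d && s a b c' d)
  h23 : ∀ a a' b b' c c' d d',
    (s a b c d && s a' b' c' d && s a b' c' d' && s a' b c d') =
      (s a' b c d && s a b' c' d && s a' b' c' d' && s a b c d')
  h34 : ∀ a a' b b' c c' d d',
    (s a b c d && s a' b c' d' && s a b' c' d' && s a' b' c d) =
      (s a' b c d && s a b c' d' && s a' b' c' d' && s a b' c d)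
  h14 : ∀ a a' b b' c c' d d',
    (s a b c d && s a' b' c d' && s a' b c' d' && s a b' c' d) =
      (s a b' c d && s a' b c d' && s a' b' c' d' && s a b c' d)

/-- The relations are stated for all levels, degenerate ones included, precisely so that they
survive relabelling; any empty cell can then be moved to 0000. -/
theorem IsToricSupport.translate {s : Fin 2 → Fin 2 → Fin 2 → Fin 2 → Bool}
    (hs : IsToricSupport s) (k₀ k₁ k₂ k₃ : Fin 2) :
    IsToricSupport fun a b c d => s (a + k₀) (b + k₁) (c + k₂) (d + k₃) :=
  ⟨fun _ _ _ _ _ _ => hs.h13 _ _ _ _ _ _, fun _ _ _ _ _ _ => hs.h24 _ _ _ _ _ _,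
    fun _ _ _ _ _ _ _ _ => hs.h12 _ _ _ _ _ _ _ _, fun _ _ _ _ _ _ _ _ => hs.h23 _ _ _ _ _ _ _ _,
    fun _ _ _ _ _ _ _ _ => hs.h34 _ _ _ _ _ _ _ _, fun _ _ _ _ _ _ _ _ => hs.h14 _ _ _ _ _ _ _ _⟩

/-- A toric support that omits `0000` is contained in a face that omits `0000`. -/
theorem IsToricSupport.exists_face_zero {s : Fin 2 → Fin 2 → Fin 2 → Fin 2 → Bool}
    (hs : IsToricSupport s) (h0 : s 0 0 0 0 = false) :
    ∃ f₁₂ f₂₃ f₃₄ f₁₄ : Fin 2 → Fin 2 → ℤ,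
      (∀ a b c d, 0 ≤ f₁₂ a b + f₂₃ b c + f₃₄ c d + f₁₄ a d) ∧
      (∀ a b c d, s a b c d = true → f₁₂ a b + f₂₃ b c + f₃₄ c d + f₁₄ a d = 0) ∧
      0 < f₁₂ 0 0 + f₂₃ 0 0 + f₃₄ 0 0 + f₁₄ 0 0 := by
  obtain ⟨h13, h24, h12, h23, h34, h14⟩ := hs
  have h := by
    refine support_subset_face_bool (s 0 0 0 1) (s 0 1 0 0) (s 0 1 0 1) ?_ (s 1 0 0 0) (s 1 0 0 1)
      (s 1 1 0 0) (s 1 1 0 1) ?_ (s 0 0 1 0) (s 0 0 1 1) (s 0 1 1 0) (s 0 1 1 1) ?_ (s 1 0 1 0) ?_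
      (s 1 0 1 1) ?_ ?_ ?_ (s 1 1 1 0) ?_ ?_ ?_ (s 1 1 1 1) ?_ ?_ ?_ ?_ ?_ ?_
    · simpa [h0, Bool.and_comm, Bool.and_left_comm, Bool.and_assoc] using (h24 0 0 1 0 0 1).symm
    · simpa [h0, Bool.and_comm, Bool.and_left_comm, Bool.and_assoc] using (h24 1 0 1 0 0 1).symm
    · simpa [h0, Bool.and_comm, Bool.and_left_comm, Bool.and_assoc] using (h24 0 0 1 1 0 1).symm
    · simpa [h0, Bool.and_comm, Bool.and_left_comm, Bool.and_assoc] using (h13 0 1 0 0 1 0).symm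
    · simpa [h0, Bool.and_comm, Bool.and_left_comm, Bool.and_assoc] using (h13 0 1 0 0 1 1).symm
    · simpa [h0, Bool.and_comm, Bool.and_left_comm, Bool.and_assoc] using h12 0 1 1 0 0 1 0 1
    · simpa [h0, Bool.and_comm, Bool.and_left_comm, Bool.and_assoc] using h23 0 1 0 1 1 0 0 1
    · simpa [h0, Bool.and_comm, Bool.and_left_comm, Bool.and_assoc] using (h13 0 1 1 0 1 0).symm
    · simpa [h0, Bool.and_comm, Bool.and_left_comm, Bool.and_assoc] using h34 0 1 0 1 0 1 1 0
    · simpa [h0, Bool.and_comm, Bool.and_left_comm, Bool.and_assoc] using h14 0 1 0 1 0 1 1 0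
    · simpa [h0, Bool.and_comm, Bool.and_left_comm, Bool.and_assoc] using (h24 1 0 1 1 0 1).symm
    · simpa [h0, Bool.and_comm, Bool.and_left_comm, Bool.and_assoc] using (h13 0 1 1 0 1 1).symm
    · simpa [h0, Bool.and_comm, Bool.and_left_comm, Bool.and_assoc] using h12 0 1 0 1 0 1 0 1
    · simpa [h0, Bool.and_comm, Bool.and_left_comm, Bool.and_assoc] using h23 0 1 0 1 0 1 0 1
    · simpa [h0, Bool.and_comm, Bool.and_left_comm, Bool.and_assoc] using h34 0 1 0 1 0 1 0 1
    · simpa [h0, Bool.and_comm, Bool.and_left_comm, Bool.and_assoc] using h14 0 1 0 1 0 1 0 1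
  simp only [Bool.or_eq_true, Bool.and_eq_true, Bool.not_eq_true'] at h
  -- `i` gives the margin at 00 of one edge. `n` on one edge and `e` on the other three give a cycle
  -- inequality: around a cycle the number of disagreements is even, so the two ends of one edge
  -- cannot agree while all three other pairs disagree. Its value at 0000 is 3 - 1.
  let e : Fin 2 → Fin 2 → ℤ := fun a b => if a = b then 1 else 0
  let i : Fin 2 → Fin 2 → ℤ := fun a b => if a = 0 ∧ b = 0 then 1 else 0
  let n : Fin 2 → Fin 2 → ℤ := fun a b => if a = b then -1 else 0
  clear h13 h24 h12 h23 h34 h14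
  rcases h with (((((((⟨⟨h1, h2⟩, h3⟩ | ⟨⟨h1, h2⟩, h3⟩) | ⟨⟨h1, h2⟩, h3⟩) | ⟨⟨h1, h2⟩, h3⟩) |
    ⟨⟨⟨⟨⟨⟨h1, h2⟩, h3⟩, h4⟩, h5⟩, h6⟩, h7⟩) | ⟨⟨⟨⟨⟨⟨h1, h2⟩, h3⟩, h4⟩, h5⟩, h6⟩, h7⟩) |
    ⟨⟨⟨⟨⟨⟨h1, h2⟩, h3⟩, h4⟩, h5⟩, h6⟩, h7⟩) | ⟨⟨⟨⟨⟨⟨h1, h2⟩, h3⟩, h4⟩, h5⟩, h6⟩, h7⟩)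
  · exact ⟨i, 0, 0, 0, by decide, by simp [Fin.forall_fin_two, i, h0, h1, h2, h3], by decide⟩
  · exact ⟨0, i, 0, 0, by decide, by simp [Fin.forall_fin_two, i, h0, h1, h2, h3], by decide⟩
  · exact ⟨0, 0, i, 0, by decide, by simp [Fin.forall_fin_two, i, h0, h1, h2, h3], by decide⟩
  · exact ⟨0, 0, 0, i, by decide, by simp [Fin.forall_fin_two, i, h0, h1, h2, h3], by decide⟩
  · exact ⟨n, e, e, e, by decide,
      by simp [Fin.forall_fin_two, e, n, h0, h1, h2, h3, h4, h5, h6, h7], by decide⟩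
  · exact ⟨e, n, e, e, by decide,
      by simp [Fin.forall_fin_two, e, n, h0, h1, h2, h3, h4, h5, h6, h7], by decide⟩
  · exact ⟨e, e, n, e, by decide,
      by simp [Fin.forall_fin_two, e, n, h0, h1, h2, h3, h4, h5, h6, h7], by decide⟩
  · exact ⟨e, e, e, n, by decide,
      by simp [Fin.forall_fin_two, e, n, h0, h1, h2, h3, h4, h5, h6, h7], by decide⟩

end Faces

/-! ### Limits of distributions factoring along the four-cycle -/

section LimitDistributions

/-- The rows of an edge are the indicators of the level pairs of its two variables, and these span
all functions of the pair. -/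
theorem mem_rowSpan_of_edge {i j : Fin 4} (hij : i ≠ j) (hg : {i, j} ∈ maximalCliques fourCycle)
    (f : Fin 2 → Fin 2 → ℝ) :
    (fun x : Fin 4 → Fin 2 => f (x i) (x j)) ∈ rowSpan fourCycleMatrix := by
  have hf : (fun x : Fin 4 → Fin 2 => f (x i) (x j)) = ∑ a, ∑ b, f a b •
      fun x => (fourCycleMatrix ⟨⟨{i, j}, hg⟩, fun v => if v.1 = i then a else b⟩ x : ℝ) := by
    funext x
    have hrow : ∀ a b, fourCycleMatrix ⟨⟨{i, j}, hg⟩, fun v => if v.1 = i then a else b⟩ x =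
        if a = x i ∧ b = x j then 1 else 0 := by
      intro a b
      rw [fourCycleMatrix, graphMatrix,
        logLinearMatrix_restrict _ hg (fun v => if v = i then a else b)]
      simp [hij.symm]
    simp only [Finset.sum_apply, Pi.smul_apply, hrow, smul_eq_mul, ite_and]
    simp
  rw [hf]
  exact Submodule.sum_mem _ fun a _ => Submodule.sum_mem _ fun b _ =>
    Submodule.smul_mem _ _ (row_mem_rowSpan _ _)

variable {P : (Fin 4 → Fin 2) → ℝ}

theorem decide_ne_zero_and (x y : ℝ) :
    (decide (x ≠ 0) && decide (y ≠ 0)) = decide (x * y ≠ 0) := by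
  simp

theorem single_eq_E (a b c d : Fin 2) : Finsupp.single ![a, b, c, d] 1 = E a b c d := rfl

/-- The marginals of a table on the four edges, at the restrictions of the state `(a, b, c, d)`. -/
def edgeMargins (u : (Fin 4 → Fin 2) →₀ ℕ) (a b c d : Fin 2) : ℕ × ℕ × ℕ × ℕ :=
  (margA u a b 0 + margA u a b 1, margA u 0 b c + margA u 1 b c,
    margB u 0 c d + margB u 1 c d, margB u a 0 d + margB u a 1 d)

theorem edgeMargins_add (u v : (Fin 4 → Fin 2) →₀ ℕ) (a b c d : Fin 2) :
    edgeMargins (u + v) a b c d = edgeMargins u a b c d + edgeMargins v a b c d := by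
  simp only [edgeMargins, margA_add, margB_add, Prod.mk_add_mk, add_add_add_comm]

theorem edgeMargins_E (a b c d x y z t : Fin 2) :
    edgeMargins (E a b c d) x y z t =
      (if a = x ∧ b = y then 1 else 0, if b = y ∧ c = z then 1 else 0,
        if c = z ∧ d = t then 1 else 0, if a = x ∧ d = t then 1 else 0) := by
  have h01 : ∀ i : Fin 2, i = 0 ∨ i = 1 := by decide
  simp only [edgeMargins, margA_E, margB_E, Prod.mk.injEq]
  refine ⟨?_, ?_, ?_, ?_⟩
  · rcases h01 c with rfl | rfl <;> simp
  · rcases h01 a with rfl | rfl <;> simp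
  · rcases h01 a with rfl | rfl <;> simp
  · rcases h01 c with rfl | rfl <;> simp

theorem sameMargins_of_edgeMargins {u v : (Fin 4 → Fin 2) →₀ ℕ}
    (h : ∀ a b c d, edgeMargins u a b c d = edgeMargins v a b c d) : SameMargins u v := by
  simp only [edgeMargins, Prod.mk.injEq] at h
  exact ⟨fun a b => (h a b 0 0).1, fun b c => (h 0 b c 0).2.1, fun c d => (h 0 0 c d).2.2.1,
    fun a d => (h a 0 0 d).2.2.2⟩

/-- Each relation comes from a binomial of the toric ideal: two equal products are both zero or both
nonzero. -/
theorem isToricSupport (hP : ∀ f ∈ toricIdeal fourCycleMatrix, eval P f = 0) :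
    IsToricSupport fun a b c d => decide (P ![a, b, c, d] ≠ 0) := by
  have h2 : ∀ {x y z t : Fin 4 → Fin 2}, SameMargins (Finsupp.single x 1 + Finsupp.single y 1)
      (Finsupp.single z 1 + Finsupp.single t 1) → P x * P y = P z * P t := by
    intro x y z t h
    have := hP _ ((monRel_two _ _ _ _).1 (monRel_fourCycle h))
    simpa [sub_eq_zero] using this
  have h4 : ∀ {x y z t x' y' z' t' : Fin 4 → Fin 2},
      SameMargins (Finsupp.single x 1 + (Finsupp.single y 1 +
          (Finsupp.single z 1 + Finsupp.single t 1)))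
        (Finsupp.single x' 1 + (Finsupp.single y' 1 +
          (Finsupp.single z' 1 + Finsupp.single t' 1))) →
      P x * P y * P z * P t = P x' * P y' * P z' * P t' := by
    intro x y z t x' y' z' t' h
    have := hP _ ((monRel_four _ _ _ _ _ _ _ _).1 (monRel_fourCycle h))
    simpa [sub_eq_zero] using this
  constructor
  all_goals
    intros
    simp only [decide_ne_zero_and]
    first
      | refine congrArg (fun r : ℝ => decide (r ≠ 0)) (h2 ?_)
      | refine congrArg (fun r : ℝ => decide (r ≠ 0)) (h4 ?_)
    refine sameMargins_of_edgeMargins fun x y z t => ?_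
    simp only [single_eq_E, edgeMargins_add, edgeMargins_E, Prod.mk_add_mk]
    -- Both tables yield the same indicators in a different order, for symbolic levels, so no case
    -- split is needed.
    ac_rfl

theorem exists_face (hP : ∀ f ∈ toricIdeal fourCycleMatrix, eval P f = 0) (k : Fin 4 → Fin 2)
    (hk : P k = 0) : ∃ ω ∈ rowSpan fourCycleMatrix, (∀ x, 0 ≤ ω x) ∧ (∀ x, P x ≠ 0 → ω x = 0) ∧
      0 < ω k := by
  have hvec : ∀ x : Fin 4 → Fin 2, ![x 0, x 1, x 2, x 3] = x := by
    intro x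
    funext i
    fin_cases i <;> rfl
  have hadd : ∀ a b : Fin 2, a + b + b = a := by decide
  have hself : ∀ a : Fin 2, a + a = 0 := by decide
  obtain ⟨f₁₂, f₂₃, f₃₄, f₁₄, hnn, hz, hpos⟩ :=
    ((isToricSupport hP).translate (k 0) (k 1) (k 2) (k 3)).exists_face_zero
      (by simp [hvec, hk])
  -- Translation by `k` is an involution on {0,1}^4 that sends `k` to 0000, so it pulls the face
  -- function found for 0000 back to one that is positive at `k`.
  refine ⟨(fun x => (f₁₂ (x 0 + k 0) (x 1 + k 1) : ℝ)) +
    (fun x => (f₂₃ (x 1 + k 1) (x 2 + k 2) : ℝ)) +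
    (fun x => (f₃₄ (x 2 + k 2) (x 3 + k 3) : ℝ)) + fun x => (f₁₄ (x 0 + k 0) (x 3 + k 3) : ℝ),
    ?_, fun x => ?_, fun x hx => ?_, ?_⟩
  · refine Submodule.add_mem _ (Submodule.add_mem _ (Submodule.add_mem _ ?_ ?_) ?_) ?_
    · exact mem_rowSpan_of_edge (i := 0) (j := 1) (by decide) (by simp [maximalCliques_fourCycle])
        fun a b => f₁₂ (a + k 0) (b + k 1)
    · exact mem_rowSpan_of_edge (i := 1) (j := 2) (by decide) (by simp [maximalCliques_fourCycle])
        fun a b => f₂₃ (a + k 1) (b + k 2)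
    · exact mem_rowSpan_of_edge (i := 2) (j := 3) (by decide) (by simp [maximalCliques_fourCycle])
        fun a b => f₃₄ (a + k 2) (b + k 3)
    · exact mem_rowSpan_of_edge (i := 0) (j := 3) (by decide) (by simp [maximalCliques_fourCycle])
        fun a b => f₁₄ (a + k 0) (b + k 3)
  · simp only [Pi.add_apply]
    exact_mod_cast hnn (x 0 + k 0) (x 1 + k 1) (x 2 + k 2) (x 3 + k 3)
  · simp only [Pi.add_apply]
    exact_mod_cast hz (x 0 + k 0) (x 1 + k 1) (x 2 + k 2) (x 3 + k 3) (by simp [hadd, hvec, hx])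
  · simp only [Pi.add_apply, hself]
    exact_mod_cast hpos

theorem isLimitOfFactoring_fourCycle (hP : P ∈ stdSimplex ℝ (Fin 4 → Fin 2))
    (h : ∀ f ∈ toricIdeal fourCycleMatrix, eval P f = 0) :
    IsLimitOfFactoring fourCycleMatrix P := by
  classical
  have hbin : ∀ u v : (Fin 4 → Fin 2) → ℕ, fourCycleMatrix.mulVec u = fourCycleMatrix.mulVec v →
      ∏ j, P j ^ u j = ∏ j, P j ^ v j := by
    intro u v huv
    have := h _ (monRel_toricIdeal (u := Finsupp.equivFunOnFinite.symm u)
      (v := Finsupp.equivFunOnFinite.symm v) (by simpa using huv))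
    rw [map_sub, eval_monomial_eq_prod, eval_monomial_eq_prod, sub_eq_zero] at this
    simpa using this
  obtain ⟨θ, hθ, hθP⟩ := exists_mem_rowSpan_exp_eq hP.1 hbin
  have hface := fun k : {k // P k = 0} => exists_face h k.1 k.2
  choose ω hω hnn hzero hpos using hface
  -- Summing one face function per zero of `P` gives a single function that is zero on the support
  -- and positive at every zero of `P`.
  refine isLimitOfFactoring_of_face hP (θ := θ) (ω := ∑ k, ω k) ?_ hθ
    (Submodule.sum_mem _ fun k _ => hω k) hθP ?_ ?_
  · exact mem_rowSpan_of_edge (i := 0) (j := 1) (by decide) (by simp [maximalCliques_fourCycle])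
      fun _ _ => 1
  · intro j hj
    rw [Finset.sum_apply]
    exact Finset.sum_eq_zero fun k _ => hzero k j hj
  · intro j hj
    rw [Finset.sum_apply]
    exact Finset.sum_pos' (fun k _ => hnn k j) ⟨⟨j, hj⟩, Finset.mem_univ _, hpos ⟨j, hj⟩⟩

theorem quadrics_union_quartics_eval_eq_zero_iff :
    (∀ f ∈ quadrics ∪ quartics, eval P f = 0) ↔
      ∀ f ∈ toricIdeal fourCycleMatrix, eval P f = 0 := by
  rw [toricIdeal_fourCycle, markovIdeal, ← Ideal.span_union]
  exact (Ideal.span_le (I := RingHom.ker (eval P))).symm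

end LimitDistributions

end GraphicalModel

theorem proposition1 :
    GraphicalModel.pairwiseIdeal GraphicalModel.fourCycle (Fin 2) =
        Ideal.span GraphicalModel.quadrics ∧
      GraphicalModel.toricIdeal GraphicalModel.fourCycleMatrix =
        GraphicalModel.pairwiseIdeal GraphicalModel.fourCycle (Fin 2) ⊔
          Ideal.span GraphicalModel.quartics ∧
      ∀ P : (Fin 4 → Fin 2) → ℝ, P ∈ stdSimplex ℝ (Fin 4 → Fin 2) →
        ((GraphicalModel.Factors GraphicalModel.fourCycleMatrix P ∨
            GraphicalModel.IsLimitOfFactoring GraphicalModel.fourCycleMatrix P) ↔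
          ∀ f ∈ GraphicalModel.quadrics ∪ GraphicalModel.quartics,
            MvPolynomial.eval P f = 0) := by
  refine ⟨GraphicalModel.pairwiseIdeal_fourCycle, ?_, fun P hP => ?_⟩
  · rw [GraphicalModel.pairwiseIdeal_fourCycle]
    exact GraphicalModel.toricIdeal_fourCycle
  · rw [GraphicalModel.quadrics_union_quartics_eval_eq_zero_iff]
    constructor
    · rintro (h | h) f hf
      · exact h.eval_eq_zero hf
      · exact h.eval_eq_zero hf
    · exact fun h => Or.inr (GraphicalModel.isLimitOfFactoring_fourCycle hP h)
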